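/- **Theorem (anisotropic equation, Dirichlet boundary condition).** Let $A_{11}=A_{22}$, $A_{12}$, $K\le 0$, $a$, $b$ be real constants with $A_{11}>2|A_{12}|$, and let $\mathcal R=[x_l,x_l+L]\times[y_l,y_l+L]$, $L>0$. Consider $$A_{11}u_{xx}+2A_{12}u_{xy}+A_{22}u_{yy}+au_x+bu_y+Ku=f \ \text{ in the interior of } \mathcal R,\qquad u=g \ \text{ on } \partial\mathcal R, \qquad (1)$$ with $u\in C^6(\mathcal R)$ and $f$ continuous on $\mathcal R$. For $N\ge 1$ put $h=L/N$, $x_i=x_l+ih$, $y_j=y_l+jh$. Given coefficients $\alpha_{pq},\beta_{pq}$ ($p,q\in\{-1,0,1\}$, depending on $h$), the scheme is $$\sum_{p,q=-1}^1\alpha_{pq}U_{i+p,j+q}=\sum_{p,q=-1}^1\beta_{pq}f(x_{i+p},y_{j+q})\quad(0<i,j<N),\qquad \sum_{p,q}\beta_{pq}=1,$$ with $U_{ij}=g(x_i,y_j)$ at boundary grid points. Its local truncation error is $T_{ij}=\sum\alpha_{pq}u(x_{i+p},y_{j+q})-\sum\beta_{pq}f(x_{i+p},y_{j+q})$. We say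 that the scheme is *fourth order on the grid with constant $C$* if $|T_{ij}|\le Ch^4$ at all interior grid points, the discrete equations have exactly one solution $U$, and $\max_{0\le i,j\le N}|u(x_i,y_j)-U_{ij}|\le Ch^4$. The *linear system* for the coefficients consists of the fifteen equations $R_{kl}=0$, $k+l\le4$, where $R_{kl}$ is the coefficient of $\partial_x^k\partial_y^l u(x_i,y_j)$ in $T_{ij}$ after Taylor expansion of $u$, and after Taylor expansion of $f$ to second order with the derivatives of $f$ up to order two expressed by (1) through those of $u$. That is, with $c^{rs}_{kl}$ the coefficient of $\partial_x^k\partial_y^lu$ in $\partial_x^r\partial_y^s f$, $$R_{kl}=\sum_{p,q}\alpha_{pq}\frac{(ph)^k(qh)^l}{k!\,l!}-\sum_{r+s\le2}c^{rs}_{kl}\sum_{p,q}\beta_{pq}\frac{(ph)^r(qh)^s}{r!\,s!}.$$ 1) Let $a=b=0$ and $\lambda=12A_{11}-Kh^2$. Let $\alpha,\beta$ be given by (rows: $q=1,0,-1$; columns: $p=-1,0,1$) $$\alpha=\frac1{\lambda h^2}\begin{bmatrix}2(A_{11}-2A_{12})(A_{11}-A_{12})&8(A_{11}^2-A_{12}^2)&2(A_{11}+A_{12})(A_{11}+2A_{12})\\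 8(A_{11}^2-A_{12}^2)&\lambda Kh^2-8(5A_{11}^2-2A_{12}^2)&8(A_{11}^2-A_{12}^2)\\ 2(A_{11}+A_{12})(A_{11}+2A_{12})&8(A_{11}^2-A_{12}^2)&2(A_{11}-2A_{12})(A_{11}-A_{12})\end{bmatrix},$$ $$\beta=\frac1{2\lambda}\begin{bmatrix}A_{11}-A_{12}&0&A_{11}+A_{12}\\0&20A_{11}-2Kh^2&0\\A_{11}+A_{12}&0&A_{11}-A_{12}\end{bmatrix}.$$ These coefficients satisfy $\sum\beta_{pq}=1$ and solve the linear system exactly for every $h>0$, and the scheme is fourth order accurate: for every solution $u$ there is a $C$, independent of $N$, such that for all $N\ge1$ the scheme is fourth order on the grid with constant $C$. 2) Let $a,b$ be arbitrary real constants. Then the HOC scheme is asymptotically fourth order convergent. Here a family $(\alpha(h),\beta(h))$ of coefficients is called *asymptotically fourth order convergent* if there is an $h_0>0$, independent of the solution, such that for every solution $u$ there is a $C$ such that for all $N$ with $h=L/N\le h_0$ the scheme is fourth order on the grid with constant $C$. Precisely: (i) For every $h>0$ there is an SVD (pseudo-inverse) solution of the linear system, that is, a pair $(\alpha,\beta)$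 with $\sum\beta_{pq}=1$ that minimizes $\sum_{k+l\le4}R_{kl}^2$ among all pairs so normalized (so it solves the system exactly when the system is consistent) and, among the minimizers, has the least $\sum\alpha_{pq}^2+\sum\beta_{pq}^2$. The scheme with these coefficients is asymptotically fourth order convergent. (ii) More generally, every *HOC family* is asymptotically fourth order convergent. A HOC family is a family $(\alpha(h),\beta(h))$ for which, with a constant $M$ and for all sufficiently small $h>0$: $\sum\beta_{pq}=1$; $|\beta_{pq}|\le M$; $|\beta_{pq}-\beta_{-p,-q}|\le Mh$; and $|R_{kl}|\le Mh^4$ for all $k+l\le4$. The SVD solutions form a HOC family, and so do, for $a=b=0$, the explicit coefficients of part 1). -/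

import Mathlib

open scoped Nat

noncomputable section

namespace HOC

/-- The constant coefficients of the operator
`L u = A11 u_xx + 2 A12 u_xy + A22 u_yy + a u_x + b u_y + K u`. -/
structure Coeffs where
  A11 : ℝ
  A12 : ℝ
  A22 : ℝ
  a : ℝ
  b : ℝ
  K : ℝ

/-- The differential operator applied to `u` at `(x, y)`, through classical partial derivatives. -/
def pdeOp (c : Coeffs) (u : ℝ → ℝ → ℝ) (x y : ℝ) : ℝ :=
  c.A11 * deriv (fun s => deriv (fun s' => u s' y) s) x
    + 2 * c.A12 * deriv (fun s => deriv (fun t => u s t) y) x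
    + c.A22 * deriv (fun t => deriv (fun t' => u x t') t) y
    + c.a * deriv (fun s => u s y) x
    + c.b * deriv (fun t => u x t) y
    + c.K * u x y

/-- The closed square `[xl, xl + L] × [yl, yl + L]`. -/
def square (xl yl L : ℝ) : Set (ℝ × ℝ) :=
  Set.Icc xl (xl + L) ×ˢ Set.Icc yl (yl + L)

/-- `u` is a `C⁶` solution (up to the boundary) of the Dirichlet problem `L u = f` in the open
square, `u = g` on its boundary. The source `f` is continuous on the closed square, so that its
values at boundary grid points, which the scheme uses, are the ones determined by the equation. -/
structure IsDirichletSolution (c : Coeffs) (xl yl L : ℝ) (f g u : ℝ → ℝ → ℝ) : Prop where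
  contDiffOn : ContDiffOn ℝ 6 (fun p : ℝ × ℝ => u p.1 p.2) (square xl yl L)
  continuousOn_source : ContinuousOn (fun p : ℝ × ℝ => f p.1 p.2) (square xl yl L)
  pde : ∀ x ∈ Set.Ioo xl (xl + L), ∀ y ∈ Set.Ioo yl (yl + L), pdeOp c u x y = f x y
  dirichlet : ∀ x ∈ Set.Icc xl (xl + L), ∀ y ∈ Set.Icc yl (yl + L),
    (x = xl ∨ x = xl + L ∨ y = yl ∨ y = yl + L) → u x y = g x y

/-- A nine-point stencil: only the values at `(i, j)` with `i, j ∈ {-1, 0, 1}` are ever used;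
`i` is the offset in the `x` direction and `j` the offset in the `y` direction. -/
abbrev Stencil := ℤ → ℤ → ℝ

/-- The offsets `-1, 0, 1`. -/
def offsets : Finset ℤ := Finset.Icc (-1) 1

/-- Sum over the nine points of the stencil. -/
def stencilSum (F : ℤ → ℤ → ℝ) : ℝ := ∑ p ∈ offsets, ∑ q ∈ offsets, F p q

/-- The local truncation error at `(x, y)` of the scheme with mesh size `h`,
coefficients `α` for `U` and `β` for `f`. -/
def truncationError (α β : Stencil) (h : ℝ) (f u : ℝ → ℝ → ℝ) (x y : ℝ) : ℝ :=
  stencilSum (fun p q => α p q * u (x + p * h) (y + q * h))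
    - stencilSum (fun p q => β p q * f (x + p * h) (y + q * h))

/-- `U` solves the finite difference equations on the grid `(xl + i h, yl + j h)`,
`0 ≤ i, j ≤ N`: the stencil equation at interior grid points and the Dirichlet condition at
boundary grid points. -/
structure IsDiscreteSolution (α β : Stencil) (xl yl h : ℝ) (N : ℕ) (f g : ℝ → ℝ → ℝ)
    (U : ℤ → ℤ → ℝ) : Prop where
  interior : ∀ i j : ℤ, 0 < i → i < N → 0 < j → j < N →
    stencilSum (fun p q => α p q * U (i + p) (j + q))
      = stencilSum (fun p q => β p q * f (xl + (i + p : ℤ) * h) (yl + (j + q : ℤ) * h))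
  boundary : ∀ i j : ℤ, 0 ≤ i → i ≤ N → 0 ≤ j → j ≤ N →
    (i = 0 ∨ i = N ∨ j = 0 ∨ j = N) → U i j = g (xl + i * h) (yl + j * h)

/-- On the grid with `N` intervals in each direction (`h = L / N`), the local truncation errors at
interior grid points are at most `C h⁴`; the finite difference equations have exactly one
solution on the grid; and its distance to `u` in the maximum norm over the grid is at most
`C h⁴`. -/
def FourthOrderOnGrid (α β : Stencil) (xl yl L : ℝ) (f g u : ℝ → ℝ → ℝ) (N : ℕ) (C : ℝ) : Prop :=
  (∀ i j : ℤ, 0 < i → i < N → 0 < j → j < N →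
    |truncationError α β (L / N) f u (xl + i * (L / N)) (yl + j * (L / N))| ≤ C * (L / N) ^ 4) ∧
  ∃ U : ℤ → ℤ → ℝ, IsDiscreteSolution α β xl yl (L / N) N f g U ∧
    (∀ V : ℤ → ℤ → ℝ, IsDiscreteSolution α β xl yl (L / N) N f g V →
      ∀ i j : ℤ, 0 ≤ i → i ≤ N → 0 ≤ j → j ≤ N → V i j = U i j) ∧
    ∀ i j : ℤ, 0 ≤ i → i ≤ N → 0 ≤ j → j ≤ N →
      |u (xl + i * (L / N)) (yl + j * (L / N)) - U i j| ≤ C * (L / N) ^ 4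

/-- Fourth-order accuracy on all grids of the scheme with coefficients `α h`, `β h`. -/
def FourthOrderAccurate (c : Coeffs) (xl yl L : ℝ) (α β : ℝ → Stencil) : Prop :=
  ∀ f g u : ℝ → ℝ → ℝ, IsDirichletSolution c xl yl L f g u →
    ∃ C : ℝ, ∀ N : ℕ, 0 < N → FourthOrderOnGrid (α (L / N)) (β (L / N)) xl yl L f g u N C

/-- Asymptotic fourth-order convergence: the same on all sufficiently fine grids, where the
threshold `h₀` depends only on the scheme and the square and not on the solution. -/
def AsymptoticallyFourthOrder (c : Coeffs) (xl yl L : ℝ) (α β : ℝ → Stencil) : Prop :=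
  ∃ h₀ : ℝ, 0 < h₀ ∧ ∀ f g u : ℝ → ℝ → ℝ, IsDirichletSolution c xl yl L f g u →
    ∃ C : ℝ, ∀ N : ℕ, 0 < N → L / N ≤ h₀ →
      FourthOrderOnGrid (α (L / N)) (β (L / N)) xl yl L f g u N C

/-- The explicit coefficients of `U` (for `A11 = A22`, `a = b = 0`). The products `i * j = 1` and
`i * j = -1` single out the two diagonals of corners, NE/SW and NW/SE. -/
def anisAlpha (A11 A12 K h : ℝ) : Stencil := fun i j =>
  1 / ((12 * A11 - K * h ^ 2) * h ^ 2) *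
    (if i = 0 ∧ j = 0 then
        (12 * A11 - K * h ^ 2) * K * h ^ 2 - 8 * (5 * A11 ^ 2 - 2 * A12 ^ 2)
      else if i * j = 1 then 2 * (A11 + A12) * (A11 + 2 * A12)
      else if i * j = -1 then 2 * (A11 - 2 * A12) * (A11 - A12)
      else 8 * (A11 ^ 2 - A12 ^ 2))

/-- The explicit coefficients of `f` (for `A11 = A22`, `a = b = 0`). -/
def anisBeta (A11 A12 K h : ℝ) : Stencil := fun i j =>
  1 / (2 * (12 * A11 - K * h ^ 2)) *
    (if i = 0 ∧ j = 0 then 20 * A11 - 2 * K * h ^ 2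
      else if i * j = 1 then A11 + A12
      else if i * j = -1 then A11 - A12
      else 0)

/-- The Taylor moment `∑ γ_{pq} (p h)^k (q h)^l / (k! l!)`. -/
def moment (γ : Stencil) (h : ℝ) (k l : ℕ) : ℝ :=
  stencilSum (fun p q => γ p q * ((p * h) ^ k * (q * h) ^ l / (k ! * l ! : ℝ)))

/-- The coefficient of `∂ₓᵏ ∂ᵧˡ u` in `∂ₓʳ ∂ᵧˢ (L u)`. -/
def pdeCoeff (c : Coeffs) (r s k l : ℕ) : ℝ :=
  (if k = r + 2 ∧ l = s then c.A11 else 0)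
    + (if k = r + 1 ∧ l = s + 1 then 2 * c.A12 else 0)
    + (if k = r ∧ l = s + 2 then c.A22 else 0)
    + (if k = r + 1 ∧ l = s then c.a else 0)
    + (if k = r ∧ l = s + 1 then c.b else 0)
    + (if k = r ∧ l = s then c.K else 0)

/-- The coefficient of `∂ₓᵏ ∂ᵧˡ u` (at the centre of the stencil) in the local truncation error,
when `f = L u` is expanded up to all its second order derivatives. The linear system for the HOC
coefficients asks that it vanish for the fifteen pairs with `k + l ≤ 4`. -/
def matchingResidual (c : Coeffs) (h : ℝ) (α β : Stencil) (k l : ℕ) : ℝ :=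
  moment α h k l
    - ∑ r ∈ Finset.range 3, ∑ s ∈ Finset.range 3,
        if r + s ≤ 2 then moment β h r s * pdeCoeff c r s k l else 0

/-- The squared Euclidean norm of the vector of the fifteen residuals. -/
def residualSq (c : Coeffs) (h : ℝ) (α β : Stencil) : ℝ :=
  ∑ k ∈ Finset.range 5, ∑ l ∈ Finset.range 5,
    if k + l ≤ 4 then matchingResidual c h α β k l ^ 2 else 0

/-- The squared Euclidean norm of the vector of the eighteen coefficients. -/
def coeffNormSq (α β : Stencil) : ℝ :=
  stencilSum (fun p q => α p q ^ 2) + stencilSum (fun p q => β p q ^ 2)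

/-- `(α, β)` is the SVD (pseudo-inverse) solution of the linear system under the normalization
`∑ β = 1`: it has the smallest residual (so it solves the system exactly if the system is
consistent), and among all such coefficients it has the smallest norm. -/
structure IsSVDSolution (c : Coeffs) (h : ℝ) (α β : Stencil) : Prop where
  normalized : stencilSum β = 1
  leastSquares : ∀ α' β' : Stencil, stencilSum β' = 1 →
    residualSq c h α β ≤ residualSq c h α' β'
  minNorm : ∀ α' β' : Stencil, stencilSum β' = 1 →
    residualSq c h α' β' ≤ residualSq c h α β → coeffNormSq α β ≤ coeffNormSq α' β'

/-- A family of HOC coefficients, indexed by the mesh size `h`: for small `h`, the coefficients of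
`f` add up to one, are bounded, and are centrally symmetric up to `O(h)` (the advection terms only
contribute perturbations of relative size `O(h)` to symmetric coefficients), and the linear system
is satisfied with residuals that are zero or `O(h⁴)`. -/
structure IsHOCFamily (c : Coeffs) (α β : ℝ → Stencil) : Prop where
  normalized : ∃ h₁ : ℝ, 0 < h₁ ∧ ∀ h : ℝ, 0 < h → h ≤ h₁ → stencilSum (β h) = 1
  bounds : ∃ M h₁ : ℝ, 0 < h₁ ∧ ∀ h : ℝ, 0 < h → h ≤ h₁ →
    (∀ p ∈ offsets, ∀ q ∈ offsets, |β h p q| ≤ M ∧ |β h p q - β h (-p) (-q)| ≤ M * h) ∧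
    ∀ k l : ℕ, k + l ≤ 4 → |matchingResidual c h (α h) (β h) k l| ≤ M * h ^ 4

end HOC

end

noncomputable section

namespace HOC

/-! ### Stencil sums -/

/-! Fourth order convergence is fourth order consistency plus stability in the maximum norm.

Stability. If the off-centre coefficients of `U` are nonnegative, grid functions can be compared
with a positive barrier that the stencil maps below a negative constant
(`IsBarrier.abs_le_of_apply`). This yields uniqueness, hence solvability of the square linear
system, and the error bound. The barrier is `2 exp (γ L) - (1 + γ h) ^ i`. The stencil acts on it
explicitly through the moments `(0,0)`, `(1,0)`, `(2,0)`, so its constants do not depend on `N`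
(`StabilityBounds.isBarrier`).

Consistency. The coefficients `α` have size `h⁻²`, so `u` is expanded to sixth order and `f = L u`
to fourth. Orders up to four in `u` produce exactly the residuals `R_kl`. What remains are the
moments of `α` of order five and those of `β` of order three, which must also be `O(h⁴)`
(`IsDirichletSolution.exists_truncationError_le`). The explicit coefficients are centrally
symmetric, so these odd moments vanish.

For a HOC family the moments come from the linear system itself. On the offsets `p ^ 3 = p`, so each
higher moment of `α` is a multiple of a lower one, and `α` can be eliminated
(`NearlyConsistent.elimination`). This fixes the low moments of `β` to leading order, and then those
of `α` (`exists_alphaMoments`). The nine moments with `k, l ≤ 2` determine `α`, and the leading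
parts of its off-centre entries are positive precisely because of `2 |A12| < A11`
(`exists_coefficient_gap`).

For the SVD solutions, a competitor with residual `O(h⁴)` is constructed
(`exists_nearlyConsistent`), so the minimizer has residual `O(h⁴)` too. Minimality of the norm makes
`β` orthogonal to all stencils invisible to the system, which leaves an explicit six-term form whose
odd part is `O(h)` (`IsSVDSolution.beta_eq`). -/

theorem stencilSum_eq (F : ℤ → ℤ → ℝ) :
    stencilSum F = F (-1) (-1) + F (-1) 0 + F (-1) 1 + (F 0 (-1) + F 0 0 + F 0 1)
      + (F 1 (-1) + F 1 0 + F 1 1) := by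
  have h : offsets = {-1, 0, 1} := by decide
  simp [stencilSum, h]
  ring

theorem stencilSum_add (F G : ℤ → ℤ → ℝ) :
    stencilSum (fun p q => F p q + G p q) = stencilSum F + stencilSum G := by
  simp only [stencilSum, Finset.sum_add_distrib]

theorem stencilSum_sub (F G : ℤ → ℤ → ℝ) :
    stencilSum (fun p q => F p q - G p q) = stencilSum F - stencilSum G := by
  simp only [stencilSum, Finset.sum_sub_distrib]

theorem stencilSum_mul_left (t : ℝ) (F : ℤ → ℤ → ℝ) :
    stencilSum (fun p q => t * F p q) = t * stencilSum F := by
  simp only [stencilSum, Finset.mul_sum]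

theorem stencilSum_mono {F G : ℤ → ℤ → ℝ}
    (h : ∀ p ∈ offsets, ∀ q ∈ offsets, F p q ≤ G p q) : stencilSum F ≤ stencilSum G :=
  Finset.sum_le_sum fun p hp => Finset.sum_le_sum fun q hq => h p hp q hq

theorem stencilSum_congr {F G : ℤ → ℤ → ℝ}
    (h : ∀ p ∈ offsets, ∀ q ∈ offsets, F p q = G p q) : stencilSum F = stencilSum G :=
  Finset.sum_congr rfl fun p hp => Finset.sum_congr rfl fun q hq => h p hp q hq

theorem abs_stencilSum_le {F : ℤ → ℤ → ℝ} {B : ℝ}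
    (h : ∀ p ∈ offsets, ∀ q ∈ offsets, |F p q| ≤ B) : |stencilSum F| ≤ 9 * B := by
  have h9 : stencilSum (fun _ _ => B) = 9 * B := by rw [stencilSum_eq]; ring
  rw [abs_le]
  constructor
  · have h9' : stencilSum (fun _ _ => -B) = -(9 * B) := by rw [stencilSum_eq]; ring
    exact h9' ▸ stencilSum_mono fun p hp q hq => (abs_le.1 (h p hp q hq)).1
  · exact h9 ▸ stencilSum_mono fun p hp q hq => (abs_le.1 (h p hp q hq)).2

/-- A stencil applied to a grid function. -/
def stencilApply (α : Stencil) (W : ℤ → ℤ → ℝ) (i j : ℤ) : ℝ :=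
  stencilSum fun p q => α p q * W (i + p) (j + q)

theorem stencilApply_add (α : Stencil) (V W : ℤ → ℤ → ℝ) (i j : ℤ) :
    stencilApply α (fun i j => V i j + W i j) i j
      = stencilApply α V i j + stencilApply α W i j := by
  simp only [stencilApply, mul_add, stencilSum_add]

theorem stencilApply_sub (α : Stencil) (V W : ℤ → ℤ → ℝ) (i j : ℤ) :
    stencilApply α (fun i j => V i j - W i j) i j
      = stencilApply α V i j - stencilApply α W i j := by
  simp only [stencilApply, mul_sub, stencilSum_sub]

theorem stencilApply_smul (α : Stencil) (t : ℝ) (W : ℤ → ℤ → ℝ) (i j : ℤ) :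
    stencilApply α (fun i j => t * W i j) i j = t * stencilApply α W i j := by
  simp only [stencilApply, ← stencilSum_mul_left]
  congr 1
  ext p q
  ring

/-! ### Discrete comparison principle -/

/-- `ψ` is a barrier for the stencil `α` on the grid with `N` intervals: the stencil is nonnegative
off its centre, `0 < ψ ≤ B` on the grid, and applying the stencil to `ψ` gives at most `-δ`. -/
structure IsBarrier (α : Stencil) (N : ℕ) (ψ : ℤ → ℤ → ℝ) (B δ : ℝ) : Prop where
  nonneg : ∀ p ∈ offsets, ∀ q ∈ offsets, ¬ (p = 0 ∧ q = 0) → 0 ≤ α p q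
  pos : ∀ i j : ℤ, 0 ≤ i → i ≤ N → 0 ≤ j → j ≤ N → 0 < ψ i j
  le : ∀ i j : ℤ, 0 ≤ i → i ≤ N → 0 ≤ j → j ≤ N → ψ i j ≤ B
  apply_le : ∀ i j : ℤ, 0 < i → i < N → 0 < j → j < N → stencilApply α ψ i j ≤ -δ
  delta_pos : 0 < δ

section Comparison

variable {α : Stencil} {N : ℕ} {ψ W : ℤ → ℤ → ℝ} {B δ τ : ℝ}

/-- A maximum principle for the quotient `W / ψ` rather than for `W`, so no sign is required of the
row sum of `α`. -/
theorem IsBarrier.le_of_apply (hψ : IsBarrier α N ψ B δ) (hτ : 0 ≤ τ)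
    (hW : ∀ i j : ℤ, 0 ≤ i → i ≤ N → 0 ≤ j → j ≤ N →
      (i = 0 ∨ i = N ∨ j = 0 ∨ j = N) → W i j = 0)
    (hα : ∀ i j : ℤ, 0 < i → i < N → 0 < j → j < N →
      τ * stencilApply α ψ i j ≤ stencilApply α W i j)
    (i j : ℤ) (hi : 0 ≤ i) (hi' : i ≤ N) (hj : 0 ≤ j) (hj' : j ≤ N) : W i j ≤ τ * ψ i j := by
  by_contra! hlt
  obtain ⟨⟨i₀, j₀⟩, h₀, hmax⟩ := Finset.exists_max_image
    (Finset.Icc (0 : ℤ) N ×ˢ Finset.Icc (0 : ℤ) N) (fun m => W m.1 m.2 / ψ m.1 m.2)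
    ⟨(i, j), by simp [*]⟩
  simp only [Finset.mem_product, Finset.mem_Icc, and_imp, Prod.forall] at h₀ hmax
  obtain ⟨⟨h1, h2⟩, h3, h4⟩ := h₀
  -- The least factor for which `t ψ` dominates `W`: the difference `W - t ψ` is nonpositive on the
  -- grid and vanishes at `(i₀, j₀)`, which is interior because `t > τ ≥ 0`. There the stencil of
  -- the difference is nonpositive, against strictness of the barrier.
  set t := W i₀ j₀ / ψ i₀ j₀ with ht
  have htτ : τ < t :=
    lt_of_lt_of_le ((lt_div_iff₀ (hψ.pos i j hi hi' hj hj')).2 hlt) (hmax i j hi hi' hj hj')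
  have hψ₀ := hψ.pos i₀ j₀ h1 h2 h3 h4
  have hle : ∀ k l : ℤ, 0 ≤ k → k ≤ N → 0 ≤ l → l ≤ N → W k l - t * ψ k l ≤ 0 := by
    intro k l hk hk' hl hl'
    have := (div_le_iff₀ (hψ.pos k l hk hk' hl hl')).1 (hmax k l hk hk' hl hl')
    linarith
  have heq : W i₀ j₀ - t * ψ i₀ j₀ = 0 := by
    rw [ht, div_mul_cancel₀ _ hψ₀.ne', sub_self]
  have hint : ¬ (i₀ = 0 ∨ i₀ = N ∨ j₀ = 0 ∨ j₀ = N) := by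
    intro hb
    have := hW i₀ j₀ h1 h2 h3 h4 hb
    have : 0 < t * ψ i₀ j₀ := mul_pos (hτ.trans_lt htτ) hψ₀
    linarith
  have hi₁ : 0 < i₀ := by omega
  have hi₂ : i₀ < N := by omega
  have hj₁ : 0 < j₀ := by omega
  have hj₂ : j₀ < N := by omega
  have hsum : stencilApply α (fun k l => W k l - t * ψ k l) i₀ j₀ ≤ 0 := by
    have h0 : stencilSum (fun _ _ => 0) = 0 := by rw [stencilSum_eq]; ring
    rw [stencilApply, ← h0]
    refine stencilSum_mono fun p hp q hq => ?_
    by_cases hpq : p = 0 ∧ q = 0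
    · obtain ⟨rfl, rfl⟩ := hpq
      simp [heq]
    · simp only [offsets, Finset.mem_Icc] at hp hq
      exact mul_nonpos_of_nonneg_of_nonpos
        (hψ.nonneg p (by simp [offsets, hp]) q (by simp [offsets, hq]) hpq)
        (hle _ _ (by omega) (by omega) (by omega) (by omega))
  rw [stencilApply_sub, stencilApply_smul] at hsum
  have hd := hψ.apply_le i₀ j₀ hi₁ hi₂ hj₁ hj₂
  have hδ := hψ.delta_pos
  have := hα i₀ j₀ hi₁ hi₂ hj₁ hj₂
  nlinarith

theorem IsBarrier.abs_le_of_apply (hψ : IsBarrier α N ψ B δ) (hτ : 0 ≤ τ)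
    (hW : ∀ i j : ℤ, 0 ≤ i → i ≤ N → 0 ≤ j → j ≤ N →
      (i = 0 ∨ i = N ∨ j = 0 ∨ j = N) → W i j = 0)
    (hα : ∀ i j : ℤ, 0 < i → i < N → 0 < j → j < N → |stencilApply α W i j| ≤ τ)
    (i j : ℤ) (hi : 0 ≤ i) (hi' : i ≤ N) (hj : 0 ≤ j) (hj' : j ≤ N) :
    |W i j| ≤ τ / δ * B := by
  have hτδ : 0 ≤ τ / δ := div_nonneg hτ hψ.delta_pos.le
  have hB := mul_le_mul_of_nonneg_left (hψ.le i j hi hi' hj hj') hτδ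
  have key : ∀ i j : ℤ, 0 < i → i < N → 0 < j → j < N →
      τ / δ * stencilApply α ψ i j ≤ -τ := by
    intro i j h1 h2 h3 h4
    calc τ / δ * stencilApply α ψ i j ≤ τ / δ * (-δ) :=
          mul_le_mul_of_nonneg_left (hψ.apply_le i j h1 h2 h3 h4) hτδ
      _ = -τ := by have := hψ.delta_pos.ne'; field_simp
  have hup := hψ.le_of_apply hτδ hW (fun i j h1 h2 h3 h4 =>
    (key i j h1 h2 h3 h4).trans (abs_le.1 (hα i j h1 h2 h3 h4)).1) i j hi hi' hj hj'
  have hdn := hψ.le_of_apply (W := fun i j => (-1) * W i j) hτδ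
    (fun i j h1 h2 h3 h4 h5 => by simp [hW i j h1 h2 h3 h4 h5])
    (fun i j h1 h2 h3 h4 => by
      rw [stencilApply_smul]
      have := key i j h1 h2 h3 h4
      have := (abs_le.1 (hα i j h1 h2 h3 h4)).2
      linarith) i j hi hi' hj hj'
  rw [abs_le]
  constructor <;> linarith

/-- With a barrier, the finite difference equations with Dirichlet condition are solvable. -/
theorem IsBarrier.exists_solution (hψ : IsBarrier α N ψ B δ) (r G : ℤ → ℤ → ℝ) :
    ∃ U : ℤ → ℤ → ℝ,
      (∀ i j : ℤ, 0 < i → i < N → 0 < j → j < N → stencilApply α U i j = r i j) ∧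
      ∀ i j : ℤ, (i = 0 ∨ i = N ∨ j = 0 ∨ j = N) → U i j = G i j := by
  classical
  let I : Finset (ℤ × ℤ) := Finset.Ioo (0 : ℤ) N ×ˢ Finset.Ioo (0 : ℤ) N
  let ext : (I → ℝ) → ℤ → ℤ → ℝ := fun w i j => if h : (i, j) ∈ I then w ⟨(i, j), h⟩ else 0
  have mem : ∀ i j : ℤ, (i, j) ∈ I ↔ (0 < i ∧ i < N) ∧ 0 < j ∧ j < N := by
    intro i j; simp [I]
  let T : (I → ℝ) →ₗ[ℝ] (I → ℝ) :=
    { toFun := fun w m => stencilApply α (ext w) m.1.1 m.1.2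
      map_add' := by
        intro v w
        ext m
        simp only [Pi.add_apply]
        rw [← stencilApply_add]
        congr 1
        ext i j
        simp only [ext]
        split_ifs <;> simp
      map_smul' := by
        intro t w
        ext m
        simp only [Pi.smul_apply, smul_eq_mul, RingHom.id_apply]
        rw [← stencilApply_smul]
        congr 1
        ext i j
        simp only [ext]
        split_ifs <;> simp }
  -- The comparison bound with `τ = 0` forces a kernel element to vanish.
  have hinj : Function.Injective T := by
    rw [injective_iff_map_eq_zero]
    intro w hw
    ext ⟨⟨i, j⟩, hm⟩
    have hm' := (mem i j).1 hm
    have := hψ.abs_le_of_apply (W := ext w) le_rfl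
      (fun i j _ _ _ _ hb => by
        have : (i, j) ∉ I := by rw [mem]; omega
        simp [ext, this])
      (fun i j h1 h2 h3 h4 => by
        have h := congrFun hw ⟨(i, j), (mem i j).2 ⟨⟨h1, h2⟩, h3, h4⟩⟩
        have h' : stencilApply α (ext w) i j = 0 := h
        simp [h'])
      i j (by omega) (by omega) (by omega) (by omega)
    simpa [ext, hm] using this
  have hsurj := LinearMap.injective_iff_surjective.1 hinj
  -- The boundary data, extended by zero to the interior, are moved to the right-hand side; the
  -- unknown `w` has zero boundary values.
  obtain ⟨w, hw⟩ := hsurj fun m =>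
    r m.1.1 m.1.2 - stencilApply α (fun i j => if (i, j) ∈ I then 0 else G i j) m.1.1 m.1.2
  refine ⟨fun i j => ext w i j + if (i, j) ∈ I then 0 else G i j, ?_, ?_⟩
  · intro i j h1 h2 h3 h4
    have h := congrFun hw ⟨(i, j), (mem i j).2 ⟨⟨h1, h2⟩, h3, h4⟩⟩
    have h' : stencilApply α (ext w) i j = r i j
      - stencilApply α (fun i j => if (i, j) ∈ I then 0 else G i j) i j := h
    rw [stencilApply_add, h']
    ring
  · intro i j hb
    have : (i, j) ∉ I := by rw [mem]; omega
    simp [ext, this]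

/-- The grid error `u - U` vanishes on the boundary and the stencil maps it to the truncation error,
so the barrier converts consistency into convergence. -/
theorem fourthOrderOnGrid_of_barrier {α β : Stencil} {xl yl L : ℝ} {f g u : ℝ → ℝ → ℝ}
    {C C' : ℝ} (hψ : IsBarrier α N ψ B δ) (hN : 0 < N) (hL : 0 < L) (hC : 0 ≤ C)
    (hu : ∀ x ∈ Set.Icc xl (xl + L), ∀ y ∈ Set.Icc yl (yl + L),
      (x = xl ∨ x = xl + L ∨ y = yl ∨ y = yl + L) → u x y = g x y)
    (hT : ∀ i j : ℤ, 0 < i → i < N → 0 < j → j < N →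
      |truncationError α β (L / N) f u (xl + i * (L / N)) (yl + j * (L / N))| ≤ C * (L / N) ^ 4)
    (hC' : C ≤ C') (hC'' : C / δ * B ≤ C') :
    FourthOrderOnGrid α β xl yl L f g u N C' := by
  have hN' : (0 : ℝ) < N := by exact_mod_cast hN
  have hh : (0 : ℝ) ≤ (L / N) ^ 4 := by positivity
  obtain ⟨U, hU, hU'⟩ := hψ.exists_solution
    (fun i j => stencilSum fun p q =>
      β p q * f (xl + (i + p : ℤ) * (L / N)) (yl + (j + q : ℤ) * (L / N)))
    (fun i j => g (xl + i * (L / N)) (yl + j * (L / N)))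
  have hUs : IsDiscreteSolution α β xl yl (L / N) N f g U :=
    ⟨hU, fun i j _ _ _ _ hb => hU' i j hb⟩
  refine ⟨fun i j h1 h2 h3 h4 => (hT i j h1 h2 h3 h4).trans
    (mul_le_mul_of_nonneg_right hC' hh), U, hUs, ?_, ?_⟩
  · intro V hV i j h1 h2 h3 h4
    have := hψ.abs_le_of_apply (W := fun i j => V i j - U i j) le_rfl
      (fun i j h1 h2 h3 h4 hb => by
        rw [hV.boundary i j h1 h2 h3 h4 hb, hUs.boundary i j h1 h2 h3 h4 hb, sub_self])
      (fun i j h1 h2 h3 h4 => by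
        have e1 := hV.interior i j h1 h2 h3 h4
        have e2 := hUs.interior i j h1 h2 h3 h4
        rw [stencilApply_sub, stencilApply, stencilApply, e1, e2, sub_self, abs_zero])
      i j h1 h2 h3 h4
    have h0 : |V i j - U i j| ≤ 0 := by simpa using this
    exact sub_eq_zero.1 (abs_nonpos_iff.1 h0)
  · intro i j h1 h2 h3 h4
    have key := hψ.abs_le_of_apply
      (W := fun i j => u (xl + i * (L / N)) (yl + j * (L / N)) - U i j)
      (τ := C * (L / N) ^ 4) (by positivity)
      (fun i j h1 h2 h3 h4 hb => by
        rw [hUs.boundary i j h1 h2 h3 h4 hb, sub_eq_zero]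
        have hmem : ∀ k : ℤ, 0 ≤ k → k ≤ N → 0 ≤ (k : ℝ) * (L / N) ∧ (k : ℝ) * (L / N) ≤ L := by
          intro k hk hk'
          have hk1 : (0 : ℝ) ≤ k := by exact_mod_cast hk
          have hk2 : (k : ℝ) ≤ N := by exact_mod_cast hk'
          refine ⟨by positivity, ?_⟩
          calc (k : ℝ) * (L / N) ≤ N * (L / N) := by gcongr
            _ = L := by field_simp
        have hNL : ((N : ℤ) : ℝ) * (L / N) = L := by push_cast; field_simp
        obtain ⟨a1, a2⟩ := hmem i h1 h2
        obtain ⟨a3, a4⟩ := hmem j h3 h4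
        refine hu _ ⟨by linarith, by linarith⟩ _ ⟨by linarith, by linarith⟩ ?_
        rcases hb with rfl | rfl | rfl | rfl
        · simp
        · right; left; rw [hNL]
        · simp
        · right; right; right; rw [hNL])
      (fun i j h1 h2 h3 h4 => by
        have e2 := hUs.interior i j h1 h2 h3 h4
        rw [stencilApply_sub]
        conv_lhs => enter [1, 2]; rw [stencilApply, e2]
        convert hT i j h1 h2 h3 h4 using 2
        simp only [truncationError, stencilApply, Int.cast_add, add_mul, add_assoc])
      i j h1 h2 h3 h4
    calc _ ≤ C * (L / N) ^ 4 / δ * B := key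
      _ = C / δ * B * (L / N) ^ 4 := by ring
      _ ≤ C' * (L / N) ^ 4 := mul_le_mul_of_nonneg_right hC'' hh

end Comparison

/-! ### Partial derivatives up to the boundary -/

/-- The derivative of `v` within `S` in the direction `e`. -/
def dirDeriv (S : Set (ℝ × ℝ)) (e : ℝ × ℝ) (v : ℝ × ℝ → ℝ) : ℝ × ℝ → ℝ :=
  fun p => fderivWithin ℝ v S p e

theorem contDiffOn_dirDeriv {S : Set (ℝ × ℝ)} (hS : UniqueDiffOn ℝ S) (e : ℝ × ℝ)
    {v : ℝ × ℝ → ℝ} {n : ℕ} (hv : ContDiffOn ℝ (n + 1 : ℕ) v S) :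
    ContDiffOn ℝ n (dirDeriv S e v) S :=
  (hv.fderivWithin hS (by norm_cast)).clm_apply contDiffOn_const

theorem contDiffOn_iterate_dirDeriv {S : Set (ℝ × ℝ)} (hS : UniqueDiffOn ℝ S) (e : ℝ × ℝ)
    (k : ℕ) {v : ℝ × ℝ → ℝ} {n : ℕ} (hv : ContDiffOn ℝ (n + k : ℕ) v S) :
    ContDiffOn ℝ n ((dirDeriv S e)^[k] v) S := by
  induction k generalizing v with
  | zero => simpa using hv
  | succ k ih => exact ih (contDiffOn_dirDeriv hS e (n := n + k) (by simpa [add_assoc] using hv))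

theorem eqOn_dirDeriv {S : Set (ℝ × ℝ)} (e : ℝ × ℝ) {v w : ℝ × ℝ → ℝ} (h : Set.EqOn v w S) :
    Set.EqOn (dirDeriv S e v) (dirDeriv S e w) S := by
  intro p hp
  simp only [dirDeriv]
  rw [fderivWithin_congr h (h hp)]

theorem eqOn_iterate_dirDeriv {S : Set (ℝ × ℝ)} (e : ℝ × ℝ) (k : ℕ) {v w : ℝ × ℝ → ℝ}
    (h : Set.EqOn v w S) : Set.EqOn ((dirDeriv S e)^[k] v) ((dirDeriv S e)^[k] w) S := by
  induction k generalizing v w with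
  | zero => exact h
  | succ k ih => exact ih (eqOn_dirDeriv e h)

/-- Symmetry of the second derivative persists at boundary points because they are limits of
interior points. -/
theorem dirDeriv_comm {S : Set (ℝ × ℝ)} (hS : UniqueDiffOn ℝ S) (hS' : S ⊆ closure (interior S))
    (e e' : ℝ × ℝ) {v : ℝ × ℝ → ℝ} (hv : ContDiffOn ℝ 2 v S) :
    Set.EqOn (dirDeriv S e (dirDeriv S e' v)) (dirDeriv S e' (dirDeriv S e v)) S := by
  intro p hp
  have hd : DifferentiableWithinAt ℝ (fderivWithin ℝ v S) S p :=
    ((hv.fderivWithin (m := 1) hS (by norm_num)).differentiableOn (by norm_num)) p hp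
  have h2 : ∀ e e' : ℝ × ℝ, dirDeriv S e (dirDeriv S e' v) p
      = fderivWithin ℝ (fderivWithin ℝ v S) S p e e' := by
    intro e e'
    change fderivWithin ℝ (fun y => fderivWithin ℝ v S y e') S p e = _
    rw [fderivWithin_clm_apply (hS p hp) hd (differentiableWithinAt_const e')]
    simp
  rw [h2, h2]
  exact ((hv p hp).isSymmSndFDerivWithinAt (by simp) hS (hS' hp) hp) e e'

theorem dirDeriv_iterate_comm {S : Set (ℝ × ℝ)} (hS : UniqueDiffOn ℝ S)
    (hS' : S ⊆ closure (interior S)) (e e' : ℝ × ℝ) (k : ℕ) {v : ℝ × ℝ → ℝ}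
    (hv : ContDiffOn ℝ (k + 1 : ℕ) v S) :
    Set.EqOn (dirDeriv S e' ((dirDeriv S e)^[k] v)) ((dirDeriv S e)^[k] (dirDeriv S e' v)) S := by
  induction k generalizing v with
  | zero => exact fun p _ => rfl
  | succ k ih =>
    have h1 := ih (contDiffOn_dirDeriv hS e hv)
    have h2 := dirDeriv_comm hS hS' e' e (hv.of_le (by norm_cast; omega))
    exact h1.trans (eqOn_iterate_dirDeriv e k h2)

/-- `V k l`, `k + l ≤ n`, behave on `S` like the partial derivatives `∂ₓᵏ ∂ᵧˡ` of a `Cⁿ`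
function. -/
structure IsJet (n : ℕ) (S : Set (ℝ × ℝ)) (V : ℕ → ℕ → ℝ × ℝ → ℝ) : Prop where
  hasFDerivWithinAt : ∀ k l, k + l < n → ∀ p ∈ S, HasFDerivWithinAt (V k l)
    (V (k + 1) l p • ContinuousLinearMap.fst ℝ ℝ ℝ
      + V k (l + 1) p • ContinuousLinearMap.snd ℝ ℝ ℝ) S p
  continuousOn : ∀ k l, k + l ≤ n → ContinuousOn (V k l) S

theorem exists_isJet {S : Set (ℝ × ℝ)} (hS : UniqueDiffOn ℝ S) (hS' : S ⊆ closure (interior S))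
    {n : ℕ} {v : ℝ × ℝ → ℝ} (hv : ContDiffOn ℝ n v S) :
    ∃ V : ℕ → ℕ → ℝ × ℝ → ℝ, V 0 0 = v ∧ IsJet n S V := by
  have hcd : ∀ m k l, m + k + l = n →
      ContDiffOn ℝ m ((dirDeriv S (1, 0))^[k] ((dirDeriv S (0, 1))^[l] v)) S := by
    intro m k l h
    refine contDiffOn_iterate_dirDeriv hS _ k (contDiffOn_iterate_dirDeriv hS _ l ?_)
    rwa [h]
  refine ⟨fun k l => (dirDeriv S (1, 0))^[k] ((dirDeriv S (0, 1))^[l] v), rfl, ?_, ?_⟩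
  · intro k l hkl p hp
    have hd := (((hcd (n - (k + l)) k l (by omega)).differentiableOn
      (by norm_cast; omega)) p hp).hasFDerivWithinAt
    refine hd.congr_fderiv (ContinuousLinearMap.ext fun e : ℝ × ℝ => ?_)
    have e1 : (dirDeriv S (1, 0))^[k + 1] ((dirDeriv S (0, 1))^[l] v) p
        = fderivWithin ℝ ((dirDeriv S (1, 0))^[k] ((dirDeriv S (0, 1))^[l] v)) S p (1, 0) := by
      rw [Function.iterate_succ_apply']; rfl
    have e2 : (dirDeriv S (1, 0))^[k] ((dirDeriv S (0, 1))^[l + 1] v) p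
        = fderivWithin ℝ ((dirDeriv S (1, 0))^[k] ((dirDeriv S (0, 1))^[l] v)) S p (0, 1) := by
      rw [Function.iterate_succ_apply']
      -- The jet takes the `y`-derivatives first, so a new one has to be moved inside the
      -- `x`-derivatives.
      refine (dirDeriv_iterate_comm hS hS' (1, 0) (0, 1) k ?_ hp).symm
      exact (hcd (n - l) 0 l (by omega)).of_le (by norm_cast; omega)
    rw [e1, e2]
    set D := fderivWithin ℝ ((dirDeriv S (1, 0))^[k] ((dirDeriv S (0, 1))^[l] v)) S p
    have he : e = e.1 • ((1 : ℝ), (0 : ℝ)) + e.2 • ((0 : ℝ), (1 : ℝ)) := by ext <;> simp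
    conv_lhs => rw [he, map_add, map_smul, map_smul]
    simp [mul_comm]
  · intro k l hkl
    exact (hcd (n - (k + l)) k l (by omega)).continuousOn

theorem IsJet.exists_bound {n : ℕ} {S : Set (ℝ × ℝ)} {V : ℕ → ℕ → ℝ × ℝ → ℝ} (hV : IsJet n S V)
    (hS : IsCompact S) : ∃ B : ℝ, 0 ≤ B ∧ ∀ k l, k + l ≤ n → ∀ p ∈ S, |V k l p| ≤ B := by
  choose C hC using fun m : ℕ × ℕ => show ∃ C : ℝ, m.1 + m.2 ≤ n → ∀ p ∈ S, |V m.1 m.2 p| ≤ C by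
    by_cases h : m.1 + m.2 ≤ n
    · obtain ⟨C, hC⟩ := hS.exists_bound_of_continuousOn (hV.continuousOn _ _ h)
      exact ⟨C, fun _ => hC⟩
    · exact ⟨0, fun h' => absurd h' h⟩
  refine ⟨∑ m ∈ Finset.range (n + 1) ×ˢ Finset.range (n + 1), |C m|,
    Finset.sum_nonneg fun _ _ => abs_nonneg _, fun k l hkl p hp => ?_⟩
  calc |V k l p| ≤ |C (k, l)| := (hC (k, l) hkl p hp).trans (le_abs_self _)
    _ ≤ _ := Finset.single_le_sum (f := fun m => |C m|) (fun _ _ => abs_nonneg _)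
      (by simp; omega)

/-- Writing `k + 1 = m.1 + m.2` and cancelling each factor against its factorial turns a homogeneous
Taylor polynomial into that of the directional derivative. This is the recursion behind the
induction in `IsJet.taylor`. -/
theorem taylor_coeff_succ (V : ℕ → ℕ → ℝ) (ξ η : ℝ) (k : ℕ) :
    ((k : ℝ) + 1) * ∑ m ∈ Finset.HasAntidiagonal.antidiagonal (k + 1),
        ξ ^ m.1 * η ^ m.2 / (m.1 ! * m.2 ! : ℝ) * V m.1 m.2
      = ∑ m ∈ Finset.HasAntidiagonal.antidiagonal k, ξ ^ m.1 * η ^ m.2 / (m.1 ! * m.2 ! : ℝ)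
        * (ξ * V (m.1 + 1) m.2 + η * V m.1 (m.2 + 1)) := by
  have h1 : ((k : ℝ) + 1) * ∑ m ∈ Finset.HasAntidiagonal.antidiagonal (k + 1),
        ξ ^ m.1 * η ^ m.2 / (m.1 ! * m.2 ! : ℝ) * V m.1 m.2
      = ∑ m ∈ Finset.HasAntidiagonal.antidiagonal (k + 1),
          (m.1 : ℝ) * (ξ ^ m.1 * η ^ m.2 / (m.1 ! * m.2 ! : ℝ) * V m.1 m.2)
        + ∑ m ∈ Finset.HasAntidiagonal.antidiagonal (k + 1),
          (m.2 : ℝ) * (ξ ^ m.1 * η ^ m.2 / (m.1 ! * m.2 ! : ℝ) * V m.1 m.2) := by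
    rw [Finset.mul_sum, ← Finset.sum_add_distrib]
    refine Finset.sum_congr rfl fun m hm => ?_
    have : ((m.1 : ℝ) + m.2) = k + 1 := by exact_mod_cast Finset.HasAntidiagonal.mem_antidiagonal.1 hm
    rw [← this]
    ring
  rw [h1, Finset.Nat.sum_antidiagonal_succ, Finset.Nat.sum_antidiagonal_succ',
    Nat.cast_zero, zero_mul, zero_mul, zero_add, zero_add, ← Finset.sum_add_distrib]
  refine Finset.sum_congr rfl fun m _ => ?_
  have a1 : (m.1 ! : ℝ) ≠ 0 := by positivity
  have a2 : (m.2 ! : ℝ) ≠ 0 := by positivity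
  have a3 : (m.1 : ℝ) + 1 ≠ 0 := by positivity
  have a4 : (m.2 : ℝ) + 1 ≠ 0 := by positivity
  simp only [Nat.factorial_succ, Nat.cast_mul, Nat.cast_add, Nat.cast_one]
  field_simp
  ring

/-- Along the segment, the derivative of the remainder is the remainder, one order lower, of the
directional derivative. Induction and the mean value inequality give the bound; the factor `1 / n!`
is not needed. The parameter `t` is there for this induction. -/
theorem IsJet.taylor {n : ℕ} {S : Set (ℝ × ℝ)} (hS : Convex ℝ S) {V : ℕ → ℕ → ℝ × ℝ → ℝ}
    (hV : IsJet n S V) {ξ η B : ℝ} (hB : ∀ k l, k + l = n → ∀ p ∈ S, |V k l p| ≤ B)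
    {p : ℝ × ℝ} (hp : p ∈ S) (hq : p + (ξ, η) ∈ S) {t : ℝ} (ht : t ∈ Set.Icc (0 : ℝ) 1) :
    |V 0 0 (p + t • (ξ, η)) - ∑ k ∈ Finset.range n, t ^ k * ∑ m ∈ Finset.HasAntidiagonal.antidiagonal k,
      ξ ^ m.1 * η ^ m.2 / (m.1 ! * m.2 ! : ℝ) * V m.1 m.2 p| ≤ (|ξ| + |η|) ^ n * B := by
  have hmem : ∀ t ∈ Set.Icc (0 : ℝ) 1, p + t • (ξ, η) ∈ S := by
    intro t ht
    have := hS.add_smul_sub_mem hp hq ht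
    simpa using this
  induction n generalizing V B t with
  | zero => simpa using hB 0 0 rfl _ (hmem t ht)
  | succ n ih =>
    let W : ℕ → ℕ → ℝ × ℝ → ℝ := fun k l p => ξ * V (k + 1) l p + η * V k (l + 1) p
    have hW : IsJet n S W := by
      refine ⟨fun k l hkl p hp => ?_, fun k l hkl => ?_⟩
      · have d1 := (hV.hasFDerivWithinAt (k + 1) l (by omega) p hp).const_mul ξ
        have d2 := (hV.hasFDerivWithinAt k (l + 1) (by omega) p hp).const_mul η
        refine (d1.add d2).congr_fderiv ?_
        refine ContinuousLinearMap.ext fun e => ?_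
        simp [W]
        ring
      · exact ((hV.continuousOn (k + 1) l (by omega)).const_smul ξ).add
          ((hV.continuousOn k (l + 1) (by omega)).const_smul η)
    have hWB : ∀ k l, k + l = n → ∀ p ∈ S, |W k l p| ≤ (|ξ| + |η|) * B := by
      intro k l hkl p hp
      calc |W k l p| ≤ |ξ * V (k + 1) l p| + |η * V k (l + 1) p| := abs_add_le _ _
        _ ≤ |ξ| * B + |η| * B := by
          rw [abs_mul, abs_mul]
          exact add_le_add
            (mul_le_mul_of_nonneg_left (hB _ _ (by omega) p hp) (abs_nonneg _))
            (mul_le_mul_of_nonneg_left (hB _ _ (by omega) p hp) (abs_nonneg _))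
        _ = _ := by ring
    have key := fun s hs => ih hW hWB (t := s) hs
    let c : ℕ → ℝ := fun k => ∑ m ∈ Finset.HasAntidiagonal.antidiagonal k,
      ξ ^ m.1 * η ^ m.2 / (m.1 ! * m.2 ! : ℝ) * V m.1 m.2 p
    have hderiv : ∀ s ∈ Set.Icc (0 : ℝ) 1, HasDerivWithinAt
        (fun s => V 0 0 (p + s • (ξ, η)) - ∑ k ∈ Finset.range (n + 1), s ^ k * c k)
        (W 0 0 (p + s • (ξ, η)) - ∑ k ∈ Finset.range n, s ^ k * ((k + 1) * c (k + 1)))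
        (Set.Icc (0 : ℝ) 1) s := by
      intro s hs
      have d1 : HasDerivWithinAt (fun s : ℝ => p + s • (ξ, η)) (ξ, η) (Set.Icc (0 : ℝ) 1) s := by
        simpa using (((hasDerivAt_id s).smul_const ((ξ, η) : ℝ × ℝ)).const_add p).hasDerivWithinAt
      have d2 := (hV.hasFDerivWithinAt 0 0 (by omega) _ (hmem s hs)).comp_hasDerivWithinAt s d1
        (fun s hs => hmem s hs)
      have d3 : HasDerivAt (fun s : ℝ => ∑ k ∈ Finset.range (n + 1), s ^ k * c k)
          (∑ k ∈ Finset.range n, s ^ k * ((k + 1) * c (k + 1))) s := by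
        have := HasDerivAt.fun_sum (u := Finset.range (n + 1)) (x := s)
          (A := fun k s => s ^ k * c k) (A' := fun k => (k * s ^ (k - 1)) * c k)
          (fun k _ => (hasDerivAt_pow k s).mul_const (c k))
        refine this.congr_deriv ?_
        rw [Finset.sum_range_succ']
        simp only [Nat.cast_zero, zero_mul, add_zero, Nat.cast_add, Nat.cast_one,
          Nat.add_sub_cancel]
        exact Finset.sum_congr rfl fun k _ => by ring
      refine (d2.sub d3.hasDerivWithinAt).congr_deriv ?_
      simp [W]
      ring
    have hbound : ∀ s ∈ Set.Ico (0 : ℝ) 1,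
        ‖W 0 0 (p + s • (ξ, η)) - ∑ k ∈ Finset.range n, s ^ k * ((k + 1) * c (k + 1))‖
          ≤ (|ξ| + |η|) ^ n * ((|ξ| + |η|) * B) := by
      intro s hs
      have := key s ⟨hs.1, hs.2.le⟩
      simp only [c, taylor_coeff_succ (fun i j => V i j p)]
      exact this
    have hfin := norm_image_sub_le_of_norm_deriv_le_segment' hderiv hbound t ht
    have h0 : V 0 0 (p + (0 : ℝ) • (ξ, η)) - ∑ k ∈ Finset.range (n + 1), (0 : ℝ) ^ k * c k = 0 := by
      rw [Finset.sum_range_succ']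
      simp [c]
    have hB0 : 0 ≤ (|ξ| + |η|) ^ n * ((|ξ| + |η|) * B) := by
      have : 0 ≤ B := (abs_nonneg _).trans (hB 0 (n + 1) (by omega) p hp)
      positivity
    rw [h0, sub_zero, sub_zero] at hfin
    calc _ ≤ (|ξ| + |η|) ^ n * ((|ξ| + |η|) * B) * t := hfin
      _ ≤ (|ξ| + |η|) ^ n * ((|ξ| + |η|) * B) * 1 := mul_le_mul_of_nonneg_left ht.2 hB0
      _ = _ := by ring

/-! ### The truncation error -/

theorem square_convex (xl yl L : ℝ) : Convex ℝ (square xl yl L) :=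
  (convex_Icc _ _).prod (convex_Icc _ _)

theorem square_isCompact (xl yl L : ℝ) : IsCompact (square xl yl L) :=
  isCompact_Icc.prod isCompact_Icc

theorem interior_square (xl yl L : ℝ) :
    interior (square xl yl L) = Set.Ioo xl (xl + L) ×ˢ Set.Ioo yl (yl + L) := by
  rw [square, interior_prod_eq, interior_Icc, interior_Icc]

theorem square_subset_closure_interior (xl yl : ℝ) {L : ℝ} (hL : 0 < L) :
    square xl yl L ⊆ closure (interior (square xl yl L)) := by
  rw [interior_square, closure_prod_eq, closure_Ioo (by linarith), closure_Ioo (by linarith)]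
  exact subset_rfl

theorem uniqueDiffOn_square (xl yl : ℝ) {L : ℝ} (hL : 0 < L) :
    UniqueDiffOn ℝ (square xl yl L) :=
  (uniqueDiffOn_Icc (by linarith)).prod (uniqueDiffOn_Icc (by linarith))

/-- The jet of `L u`, from the jet of `u`. -/
def pdeJet (c : Coeffs) (V : ℕ → ℕ → ℝ × ℝ → ℝ) (r s : ℕ) (p : ℝ × ℝ) : ℝ :=
  c.A11 * V (r + 2) s p + 2 * c.A12 * V (r + 1) (s + 1) p + c.A22 * V r (s + 2) p
    + c.a * V (r + 1) s p + c.b * V r (s + 1) p + c.K * V r s p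

theorem IsJet.pdeJet {n : ℕ} {S : Set (ℝ × ℝ)} {V : ℕ → ℕ → ℝ × ℝ → ℝ} (c : Coeffs)
    (hV : IsJet (n + 2) S V) : IsJet n S (pdeJet c V) := by
  refine ⟨fun k l hkl p hp => ?_, fun k l hkl => ?_⟩
  · have d1 := (hV.hasFDerivWithinAt (k + 2) l (by omega) p hp).const_mul c.A11
    have d2 := (hV.hasFDerivWithinAt (k + 1) (l + 1) (by omega) p hp).const_mul (2 * c.A12)
    have d3 := (hV.hasFDerivWithinAt k (l + 2) (by omega) p hp).const_mul c.A22
    have d4 := (hV.hasFDerivWithinAt (k + 1) l (by omega) p hp).const_mul c.a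
    have d5 := (hV.hasFDerivWithinAt k (l + 1) (by omega) p hp).const_mul c.b
    have d6 := (hV.hasFDerivWithinAt k l (by omega) p hp).const_mul c.K
    refine (((((d1.add d2).add d3).add d4).add d5).add d6).congr_fderiv ?_
    refine ContinuousLinearMap.ext fun e : ℝ × ℝ => ?_
    simp [HOC.pdeJet, add_right_comm _ 2 1]
    ring
  · have d1 := (hV.continuousOn (k + 2) l (by omega)).const_smul c.A11
    have d2 := (hV.continuousOn (k + 1) (l + 1) (by omega)).const_smul (2 * c.A12)
    have d3 := (hV.continuousOn k (l + 2) (by omega)).const_smul c.A22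
    have d4 := (hV.continuousOn (k + 1) l (by omega)).const_smul c.a
    have d5 := (hV.continuousOn k (l + 1) (by omega)).const_smul c.b
    have d6 := (hV.continuousOn k l (by omega)).const_smul c.K
    exact ((((d1.add d2).add d3).add d4).add d5).add d6

theorem IsJet.hasDerivAt_fst {n : ℕ} {S : Set (ℝ × ℝ)} {V : ℕ → ℕ → ℝ × ℝ → ℝ}
    (hV : IsJet n S V) {k l : ℕ} (hkl : k + l < n) {x y : ℝ} (h : (x, y) ∈ interior S) :
    HasDerivAt (fun s => V k l (s, y)) (V (k + 1) l (x, y)) x := by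
  have d1 := (hV.hasFDerivWithinAt k l hkl _ (interior_subset h)).hasFDerivAt
    (mem_interior_iff_mem_nhds.1 h)
  have d2 : HasDerivAt (fun s : ℝ => (s, y)) ((1 : ℝ), (0 : ℝ)) x :=
    (hasDerivAt_id x).prodMk (hasDerivAt_const x y)
  exact (d1.comp_hasDerivAt x d2).congr_deriv (by simp)

theorem IsJet.hasDerivAt_snd {n : ℕ} {S : Set (ℝ × ℝ)} {V : ℕ → ℕ → ℝ × ℝ → ℝ}
    (hV : IsJet n S V) {k l : ℕ} (hkl : k + l < n) {x y : ℝ} (h : (x, y) ∈ interior S) :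
    HasDerivAt (fun t => V k l (x, t)) (V k (l + 1) (x, y)) y := by
  have d1 := (hV.hasFDerivWithinAt k l hkl _ (interior_subset h)).hasFDerivAt
    (mem_interior_iff_mem_nhds.1 h)
  have d2 : HasDerivAt (fun t : ℝ => (x, t)) ((0 : ℝ), (1 : ℝ)) y :=
    (hasDerivAt_const y x).prodMk (hasDerivAt_id y)
  exact (d1.comp_hasDerivAt y d2).congr_deriv (by simp)

theorem IsJet.pdeOp_eq {n : ℕ} {S : Set (ℝ × ℝ)} {V : ℕ → ℕ → ℝ × ℝ → ℝ} (c : Coeffs)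
    {u : ℝ → ℝ → ℝ} (hV : IsJet (n + 2) S V) (hu : V 0 0 = fun p => u p.1 p.2) {x y : ℝ}
    (h : (x, y) ∈ interior S) : pdeOp c u x y = HOC.pdeJet c V 0 0 (x, y) := by
  have ev1 : ∀ᶠ s in nhds x, (s, y) ∈ interior S :=
    (Continuous.prodMk_left y).continuousAt.eventually (isOpen_interior.mem_nhds h)
  have ev2 : ∀ᶠ t in nhds y, (x, t) ∈ interior S :=
    (Continuous.prodMk_right x).continuousAt.eventually (isOpen_interior.mem_nhds h)
  have hx : ∀ {x y}, (x, y) ∈ interior S → deriv (fun s => u s y) x = V 1 0 (x, y) := by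
    intro x y h
    have := hV.hasDerivAt_fst (k := 0) (l := 0) (by omega) h
    rw [hu] at this
    exact this.deriv
  have hy : ∀ {x y}, (x, y) ∈ interior S → deriv (fun t => u x t) y = V 0 1 (x, y) := by
    intro x y h
    have := hV.hasDerivAt_snd (k := 0) (l := 0) (by omega) h
    rw [hu] at this
    exact this.deriv
  have hxx : deriv (fun s => deriv (fun s' => u s' y) s) x = V 2 0 (x, y) := by
    rw [Filter.EventuallyEq.deriv_eq (ev1.mono fun s hs => hx hs)]
    exact (hV.hasDerivAt_fst (by omega) h).deriv
  have hyy : deriv (fun t => deriv (fun t' => u x t') t) y = V 0 2 (x, y) := by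
    rw [Filter.EventuallyEq.deriv_eq (ev2.mono fun t ht => hy ht)]
    exact (hV.hasDerivAt_snd (by omega) h).deriv
  have hxy : deriv (fun s => deriv (fun t => u s t) y) x = V 1 1 (x, y) := by
    rw [Filter.EventuallyEq.deriv_eq (ev1.mono fun s hs => hy hs)]
    exact (hV.hasDerivAt_fst (by omega) h).deriv
  rw [pdeOp, hxx, hyy, hxy, hx h, hy h, HOC.pdeJet]
  simp [hu]

/-- The equation is given only in the open square; continuity of `f` and of the jet carries it to
the boundary, where the scheme also samples `f`. -/
theorem IsDirichletSolution.exists_jet {c : Coeffs} {xl yl L : ℝ} {f g u : ℝ → ℝ → ℝ}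
    (hu : IsDirichletSolution c xl yl L f g u) (hL : 0 < L) :
    ∃ V : ℕ → ℕ → ℝ × ℝ → ℝ, IsJet 6 (square xl yl L) V ∧ (V 0 0 = fun p => u p.1 p.2) ∧
      ∀ p ∈ square xl yl L, f p.1 p.2 = pdeJet c V 0 0 p := by
  obtain ⟨V, hV0, hV⟩ := exists_isJet (uniqueDiffOn_square xl yl hL)
    (square_subset_closure_interior xl yl hL) (n := 6) hu.contDiffOn
  refine ⟨V, hV, hV0, ?_⟩
  refine Set.EqOn.of_subset_closure (s := interior (square xl yl L)) ?_ hu.continuousOn_source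
    ((hV.pdeJet (n := 4) c).continuousOn 0 0 (by omega)) interior_subset
    (square_subset_closure_interior xl yl hL)
  rintro ⟨x, y⟩ h
  rw [← hV.pdeOp_eq (n := 4) c hV0 h]
  rw [interior_square] at h
  exact (hu.pde x h.1 y h.2).symm

theorem stencilSum_taylor {n : ℕ} {S : Set (ℝ × ℝ)} (hS : Convex ℝ S)
    {V : ℕ → ℕ → ℝ × ℝ → ℝ} (hV : IsJet n S V) {B G h x y : ℝ} (hh : 0 ≤ h)
    (hB : ∀ k l, k + l = n → ∀ p ∈ S, |V k l p| ≤ B) {γ : Stencil}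
    (hγ : ∀ p ∈ offsets, ∀ q ∈ offsets, |γ p q| ≤ G)
    (hmem : ∀ p ∈ offsets, ∀ q ∈ offsets, (x + p * h, y + q * h) ∈ S) :
    |stencilSum (fun p q => γ p q * V 0 0 (x + p * h, y + q * h))
      - ∑ k ∈ Finset.range n, ∑ m ∈ Finset.HasAntidiagonal.antidiagonal k,
        moment γ h m.1 m.2 * V m.1 m.2 (x, y)| ≤ 9 * (G * ((2 * h) ^ n * B)) := by
  have h0 : (0 : ℤ) ∈ offsets := by decide
  have hxy : (x, y) ∈ S := by simpa using hmem 0 h0 0 h0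
  have hB0 : 0 ≤ B := (abs_nonneg _).trans (hB 0 n (by omega) _ hxy)
  have e : ∑ k ∈ Finset.range n, ∑ m ∈ Finset.HasAntidiagonal.antidiagonal k,
        moment γ h m.1 m.2 * V m.1 m.2 (x, y)
      = stencilSum fun p q => γ p q * ∑ k ∈ Finset.range n,
        ∑ m ∈ Finset.HasAntidiagonal.antidiagonal k,
        (p * h) ^ m.1 * (q * h) ^ m.2 / (m.1 ! * m.2 ! : ℝ) * V m.1 m.2 (x, y) := by
    simp only [stencilSum_eq, moment, Finset.mul_sum, ← Finset.sum_add_distrib]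
    exact Finset.sum_congr rfl fun k _ => Finset.sum_congr rfl fun m _ => by ring
  rw [e, ← stencilSum_sub]
  refine abs_stencilSum_le fun p hp q hq => ?_
  rw [← mul_sub, abs_mul]
  have hpq : |(p : ℝ) * h| + |(q : ℝ) * h| ≤ 2 * h := by
    have aux : ∀ p ∈ offsets, |(p : ℝ)| ≤ 1 := by
      intro p hp
      simp only [offsets, Finset.mem_Icc] at hp
      rw [abs_le]
      exact ⟨by exact_mod_cast hp.1, by exact_mod_cast hp.2⟩
    rw [abs_mul, abs_mul, abs_of_nonneg hh]
    nlinarith [aux p hp, aux q hq]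
  have key := hV.taylor hS hB hxy (ξ := p * h) (η := q * h) (by simpa using hmem p hp q hq)
    (t := 1) (by simp)
  simp only [one_smul, one_pow, one_mul, Prod.mk_add_mk] at key
  refine mul_le_mul (hγ p hp q hq) (key.trans ?_) (abs_nonneg _)
    ((abs_nonneg _).trans (hγ p hp q hq))
  gcongr

/-- The bounds on the coefficients of a scheme with mesh size `h` which make its truncation
error of order `h⁴`. -/
structure TruncationBounds (c : Coeffs) (M h : ℝ) (α β : Stencil) : Prop where
  alpha_le : ∀ p ∈ offsets, ∀ q ∈ offsets, |α p q| ≤ M / h ^ 2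
  beta_le : ∀ p ∈ offsets, ∀ q ∈ offsets, |β p q| ≤ M
  alpha_moment : ∀ k l, k + l = 5 → |moment α h k l| ≤ M * h ^ 4
  beta_moment : ∀ k l, k + l = 3 → |moment β h k l| ≤ M * h ^ 4
  residual : ∀ k l, k + l ≤ 4 → |matchingResidual c h α β k l| ≤ M * h ^ 4

/-- Regrouping by derivatives of `u`: derivatives of `f` of order at most two involve those of `u`
of order at most four, so nothing is lost by the truncation. -/
theorem sum_matchingResidual (c : Coeffs) (h : ℝ) (α β : Stencil) (V : ℕ → ℕ → ℝ × ℝ → ℝ)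
    (z : ℝ × ℝ) :
    ∑ k ∈ Finset.range 5, ∑ m ∈ Finset.HasAntidiagonal.antidiagonal k,
        matchingResidual c h α β m.1 m.2 * V m.1 m.2 z
      = ∑ k ∈ Finset.range 5, ∑ m ∈ Finset.HasAntidiagonal.antidiagonal k,
          moment α h m.1 m.2 * V m.1 m.2 z
        - ∑ k ∈ Finset.range 3, ∑ m ∈ Finset.HasAntidiagonal.antidiagonal k,
          moment β h m.1 m.2 * pdeJet c V m.1 m.2 z := by
  simp only [matchingResidual, pdeJet, pdeCoeff, Finset.sum_range_succ, Finset.range_zero,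
    Finset.sum_empty, Finset.Nat.antidiagonal_succ, Finset.Nat.antidiagonal_zero,
    Finset.sum_cons, Finset.map_singleton, Finset.map_cons, Finset.sum_singleton,
    Function.Embedding.prodMap, Function.Embedding.coeFn_mk, Prod.map, Function.Embedding.refl_apply]
  simp
  ring

theorem abs_sum_antidiagonal_le {F : ℕ → ℕ → ℝ} {B : ℝ} (n : ℕ)
    (h : ∀ k l, k + l = n → |F k l| ≤ B) :
    |∑ m ∈ Finset.HasAntidiagonal.antidiagonal n, F m.1 m.2| ≤ (n + 1) * B := by
  refine (Finset.abs_sum_le_sum_abs _ _).trans ?_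
  refine (Finset.sum_le_card_nsmul _ _ B fun m hm =>
    h _ _ (Finset.HasAntidiagonal.mem_antidiagonal.1 hm)).trans_eq ?_
  simp

theorem IsDirichletSolution.exists_truncationError_le {c : Coeffs} {xl yl L : ℝ}
    {f g u : ℝ → ℝ → ℝ} (hu : IsDirichletSolution c xl yl L f g u) (hL : 0 < L) (M : ℝ) :
    ∃ C : ℝ, 0 ≤ C ∧ ∀ (h : ℝ) (α β : Stencil) (x y : ℝ), 0 < h →
      TruncationBounds c M h α β →
      (∀ p ∈ offsets, ∀ q ∈ offsets, (x + p * h, y + q * h) ∈ square xl yl L) →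
      |truncationError α β h f u x y| ≤ C * h ^ 4 := by
  obtain ⟨V, hV, hV0, hVf⟩ := hu.exists_jet hL
  have hF := hV.pdeJet (n := 4) c
  obtain ⟨B, hB0, hB⟩ := hV.exists_bound (square_isCompact xl yl L)
  obtain ⟨B', hB0', hB'⟩ := hF.exists_bound (square_isCompact xl yl L)
  -- Here `576 = 9 * 2 ^ 6` and `144 = 9 * 2 ^ 4` come from the two Taylor remainders. The others
  -- count derivatives: 15 of order at most four, 6 of order five, 4 of order three.
  refine ⟨(576 + 15 + 6) * (|M| * B) + (144 + 4) * (|M| * B'), by positivity, ?_⟩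
  intro h α β x y hh hT hmem
  have hh4 : 0 ≤ h ^ 4 := by positivity
  have h0 : (0 : ℤ) ∈ offsets := by decide
  have hxy : (x, y) ∈ square xl yl L := by simpa using hmem 0 h0 0 h0
  have hM : M ≤ |M| := le_abs_self M
  have tα := stencilSum_taylor (square_convex xl yl L) hV hh.le
    (fun k l hkl => hB k l hkl.le) hT.alpha_le hmem
  have tβ := stencilSum_taylor (square_convex xl yl L) hF hh.le
    (fun k l hkl => hB' k l hkl.le) hT.beta_le hmem
  have eT : truncationError α β h f u x y
      = stencilSum (fun p q => α p q * V 0 0 (x + p * h, y + q * h))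
        - stencilSum (fun p q => β p q * pdeJet c V 0 0 (x + p * h, y + q * h)) := by
    rw [truncationError, hV0]
    congr 1
    exact stencilSum_congr fun p hp q hq => by rw [← hVf _ (hmem p hp q hq)]
  have mulB : ∀ {r v b : ℝ}, |r| ≤ M * h ^ 4 → |v| ≤ b → |r * v| ≤ |M| * b * h ^ 4 := by
    intro r v b hr hv
    rw [abs_mul]
    calc |r| * |v| ≤ (|M| * h ^ 4) * b := mul_le_mul
          (hr.trans (mul_le_mul_of_nonneg_right hM hh4)) hv (abs_nonneg _) (by positivity)
      _ = _ := by ring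
  have a5 := abs_sum_antidiagonal_le (F := fun k l => moment α h k l * V k l (x, y)) 5
    fun k l hkl => mulB (hT.alpha_moment k l hkl) (hB k l (by omega) _ hxy)
  have b3 := abs_sum_antidiagonal_le (F := fun k l => moment β h k l * pdeJet c V k l (x, y)) 3
    fun k l hkl => mulB (hT.beta_moment k l hkl) (hB' k l (by omega) _ hxy)
  have r4 : |∑ k ∈ Finset.range 5, ∑ m ∈ Finset.HasAntidiagonal.antidiagonal k,
      matchingResidual c h α β m.1 m.2 * V m.1 m.2 (x, y)| ≤ 15 * (|M| * B * h ^ 4) := by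
    refine (Finset.abs_sum_le_sum_abs _ _).trans ((Finset.sum_le_sum fun k hk =>
      abs_sum_antidiagonal_le (F := fun i j => matchingResidual c h α β i j * V i j (x, y)) k
        fun i j hij => mulB (hT.residual i j ?_) (hB i j ?_ _ hxy)).trans_eq ?_)
    · have := Finset.mem_range.1 hk; omega
    · have := Finset.mem_range.1 hk; omega
    · simp only [Finset.sum_range_succ, Finset.range_zero, Finset.sum_empty]
      push_cast
      ring
  rw [sum_matchingResidual] at r4
  rw [Finset.sum_range_succ] at tα tβ
  have cα : 9 * (M / h ^ 2 * ((2 * h) ^ 6 * B)) ≤ 576 * (|M| * B) * h ^ 4 := by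
    calc _ = 576 * (M * B) * h ^ 4 := by field_simp; ring
      _ ≤ _ := by gcongr
  have cβ : 9 * (M * ((2 * h) ^ 4 * B')) ≤ 144 * (|M| * B') * h ^ 4 := by
    calc _ = 144 * (M * B') * h ^ 4 := by ring
      _ ≤ _ := by gcongr
  replace tα := tα.trans cα
  replace tβ := tβ.trans cβ
  push_cast at a5 b3
  rw [eT]
  rw [abs_le] at tα tβ a5 b3 r4 ⊢
  constructor <;> linarith [tα.1, tβ.1, a5.1, b3.1, r4.1, tα.2, tβ.2, a5.2, b3.2, r4.2]

/-! ### A geometric barrier -/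

/-- Bounds on the coefficients of `U` under which `2 exp (γ L) - (1 + γ h) ^ i` is a barrier. -/
structure StabilityBounds (L γ δ ε h : ℝ) (α : Stencil) : Prop where
  nonneg : ∀ p ∈ offsets, ∀ q ∈ offsets, ¬ (p = 0 ∧ q = 0) → 0 ≤ α p q
  zeroth : moment α h 0 0 ≤ ε
  second : δ + 2 * ε * Real.exp (γ * L)
    ≤ γ / (1 + γ * h) * (γ * moment α h 2 0 + (1 + γ * h / 2) * moment α h 1 0)

theorem StabilityBounds.isBarrier {L γ δ ε h : ℝ} {α : Stencil} {N : ℕ}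
    (hα : StabilityBounds L γ δ ε h α) (hγ : 0 < γ) (hδ : 0 < δ) (hε : 0 ≤ ε) (hh : 0 < h)
    (hN : N * h = L) :
    IsBarrier α N (fun i _ => 2 * Real.exp (γ * L) - (1 + γ * h) ^ i)
      (2 * Real.exp (γ * L)) δ := by
  set E := Real.exp (γ * L)
  have hE : 0 < E := Real.exp_pos _
  have hz : 1 ≤ 1 + γ * h := by nlinarith
  have hz0 : 0 < 1 + γ * h := by linarith
  -- From `1 + γ h ≤ exp (γ h)` and `N h = L`; thus the barrier lies between `E` and `2 E` on every
  -- grid.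
  have hzE : ∀ i : ℤ, 0 ≤ i → i ≤ N → 1 ≤ (1 + γ * h) ^ i ∧ (1 + γ * h) ^ i ≤ E := by
    intro i hi hi'
    lift i to ℕ using hi
    rw [zpow_natCast]
    refine ⟨one_le_pow₀ hz, ?_⟩
    calc (1 + γ * h) ^ i ≤ (1 + γ * h) ^ N := pow_le_pow_right₀ hz (by exact_mod_cast hi')
      _ ≤ Real.exp (γ * h) ^ N :=
        pow_le_pow_left₀ hz0.le (by rw [add_comm]; exact Real.add_one_le_exp _) N
      _ = E := by rw [← Real.exp_nat_mul]; simp only [E, ← hN]; congr 1; ring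
  refine ⟨hα.nonneg, fun i j h1 h2 _ _ => ?_, fun i j h1 h2 _ _ => ?_,
    fun i j h1 h2 _ _ => ?_, hδ⟩
  · linarith [hzE i h1 h2]
  · linarith [hzE i h1 h2]
  · obtain ⟨e1, e2⟩ := hzE i h1.le h2.le
    set X := γ / (1 + γ * h) * (γ * moment α h 2 0 + (1 + γ * h / 2) * moment α h 1 0) with hX
    -- A geometric sequence is an eigenfunction of the stencil. Its eigenvalue is `moment α h 0 0 +
    -- X`, obtained by expressing the sums of `α` over the columns `p = ±1` through the moments
    -- `(1,0)` and `(2,0)`.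
    have key : stencilApply α (fun i _ => 2 * E - (1 + γ * h) ^ i) i j
        = moment α h 0 0 * (2 * E - (1 + γ * h) ^ i) - (1 + γ * h) ^ i * X := by
      rw [hX]
      simp only [stencilApply, moment, stencilSum_eq, zpow_add₀ hz0.ne', zpow_neg, zpow_one,
        zpow_zero]
      simp
      field_simp
      ring
    have hs := hα.second
    have h0 := hα.zeroth
    have p1 : moment α h 0 0 * (2 * E - (1 + γ * h) ^ i) ≤ ε * (2 * E) := by
      calc _ ≤ ε * (2 * E - (1 + γ * h) ^ i) :=
            mul_le_mul_of_nonneg_right h0 (by linarith)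
        _ ≤ _ := mul_le_mul_of_nonneg_left (by linarith) hε
    have hX0 : 0 ≤ X := by
      have : 0 ≤ 2 * ε * E := by positivity
      linarith
    rw [key]
    nlinarith

/-- The common end of both parts of the theorem: `M`, `γ`, `δ`, `ε` are fixed before `N`, which
makes `C` uniform in the grid and in the coefficients. -/
theorem IsDirichletSolution.exists_fourthOrderOnGrid {c : Coeffs} {xl yl L : ℝ}
    {f g u : ℝ → ℝ → ℝ} (hu : IsDirichletSolution c xl yl L f g u) (hL : 0 < L)
    (M : ℝ) {γ δ ε : ℝ} (hγ : 0 < γ) (hδ : 0 < δ) (hε : 0 ≤ ε) :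
    ∃ C : ℝ, ∀ N : ℕ, 0 < N → ∀ α β : Stencil, TruncationBounds c M (L / N) α β →
      StabilityBounds L γ δ ε (L / N) α → FourthOrderOnGrid α β xl yl L f g u N C := by
  obtain ⟨C, hC, hT⟩ := hu.exists_truncationError_le hL M
  refine ⟨max C (C / δ * (2 * Real.exp (γ * L))), fun N hN α β hαβ hα => ?_⟩
  have hN' : (0 : ℝ) < N := by exact_mod_cast hN
  have hh : 0 < L / N := by positivity
  have hNL : N * (L / N) = L := by field_simp
  refine fourthOrderOnGrid_of_barrier (hα.isBarrier hγ hδ hε hh hNL) hN hL hC hu.dirichlet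
    (fun i j h1 h2 h3 h4 => hT _ α β _ _ hh hαβ ?_) (le_max_left _ _) (le_max_right _ _)
  have aux : ∀ i : ℤ, 0 < i → i < N → ∀ p ∈ offsets,
      0 ≤ (i : ℝ) * (L / N) + p * (L / N) ∧ (i : ℝ) * (L / N) + p * (L / N) ≤ L := by
    intro i hi hi' p hp
    simp only [offsets, Finset.mem_Icc] at hp
    have a1 : (0 : ℝ) ≤ i + p := by exact_mod_cast (by omega : 0 ≤ i + p)
    have a2 : (i : ℝ) + p ≤ N := by exact_mod_cast (by omega : i + p ≤ N)
    rw [← add_mul]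
    refine ⟨by positivity, ?_⟩
    calc _ ≤ N * (L / N) := mul_le_mul_of_nonneg_right a2 hh.le
      _ = L := hNL
  intro p hp q hq
  obtain ⟨b1, b2⟩ := aux i h1 h2 p hp
  obtain ⟨b3, b4⟩ := aux j h3 h4 q hq
  exact ⟨⟨by simp only []; linarith, by simp only []; linarith⟩,
    ⟨by simp only []; linarith, by simp only []; linarith⟩⟩

/-! ### Odd moments -/

/-- Pairing `(p, q)` with `(-p, -q)`: odd moments see only the centrally antisymmetric part of a
stencil. -/
theorem two_mul_moment_of_odd (γ : Stencil) (h : ℝ) {k l : ℕ} (hkl : Odd (k + l)) :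
    2 * moment γ h k l = stencilSum fun p q =>
      (γ p q - γ (-p) (-q)) * ((p * h) ^ k * (q * h) ^ l / (k ! * l ! : ℝ)) := by
  have neg : ∀ x y : ℝ, (-x) ^ k * (-y) ^ l = -(x ^ k * y ^ l) := by
    intro x y
    rw [neg_pow x, neg_pow y, mul_mul_mul_comm, ← pow_add, hkl.neg_one_pow, neg_one_mul]
  have hs : ∀ p q : ℤ, ((-p : ℤ) * h) ^ k * ((-q : ℤ) * h) ^ l / (k ! * l ! : ℝ)
      = -((p * h) ^ k * (q * h) ^ l / (k ! * l ! : ℝ)) := by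
    intro p q
    rw [Int.cast_neg, Int.cast_neg, neg_mul, neg_mul, neg, neg_div]
  have h1 := hs 1 1
  have h2 := hs 1 (-1)
  have h3 := hs 1 0
  have h4 := hs 0 1
  have h5 := hs 0 0
  simp only [neg_neg, neg_zero] at h1 h2 h3 h4 h5
  simp only [moment, stencilSum_eq, neg_neg, neg_zero, h1, h2, h3, h4]
  rw [show ((0 : ℤ) * h) ^ k * ((0 : ℤ) * h) ^ l / (k ! * l ! : ℝ) = 0 by linarith]
  ring

theorem moment_eq_zero_of_odd {γ : Stencil} (hγ : ∀ p q, γ (-p) (-q) = γ p q) (h : ℝ) {k l : ℕ}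
    (hkl : Odd (k + l)) : moment γ h k l = 0 := by
  have := two_mul_moment_of_odd γ h hkl
  simp only [hγ, sub_self, zero_mul] at this
  rw [stencilSum_eq] at this
  linarith

/-! ### The explicit coefficients -/

section Explicit

variable {A D K h : ℝ}

theorem le_anis_denom (hK : K ≤ 0) : 12 * A ≤ 12 * A - K * h ^ 2 := by
  nlinarith [sq_nonneg h]

theorem stencilSum_anisBeta (hA : 0 < A) (hK : K ≤ 0) :
    stencilSum (anisBeta A D K h) = 1 := by
  have hl : 12 * A - K * h ^ 2 ≠ 0 := by
    have := le_anis_denom (A := A) (h := h) hK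
    intro h0; linarith
  simp [stencilSum_eq, anisBeta]
  field_simp
  ring

theorem matchingResidual_anis (hA : 0 < A) (hK : K ≤ 0) (hh : 0 < h) {k l : ℕ}
    (hkl : k + l ≤ 4) : matchingResidual ⟨A, D, A, 0, 0, K⟩ h
      (anisAlpha A D K h) (anisBeta A D K h) k l = 0 := by
  have hl : 12 * A - K * h ^ 2 ≠ 0 := by
    have := le_anis_denom (A := A) (h := h) hK
    intro h0; linarith
  have hh' := hh.ne'
  have hk : k ≤ 4 := by omega
  have hl' : l ≤ 4 := by omega
  interval_cases k <;> interval_cases l <;> first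
    | (exfalso; omega)
    | (simp [matchingResidual, moment, pdeCoeff, stencilSum_eq, anisAlpha, anisBeta,
        Finset.sum_range_succ, Nat.factorial]
       try field_simp
       try ring)

theorem abs_anisBeta_le (hA : 0 < A) (hD : 2 * |D| < A) (hK : K ≤ 0) {p q : ℤ} :
    |anisBeta A D K h p q| ≤ 1 := by
  have hl := le_anis_denom (A := A) (h := h) hK
  have hKh : K * h ^ 2 ≤ 0 := by linarith
  have hl0 : 0 < 2 * (12 * A - K * h ^ 2) := by linarith
  obtain ⟨d1, d2⟩ := abs_le.1 (le_refl |D|)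
  rw [anisBeta, one_div_mul_eq_div, abs_div, abs_of_pos hl0, div_le_one hl0, abs_le]
  split_ifs <;> constructor <;> linarith

theorem anisAlpha_neg (p q : ℤ) : anisAlpha A D K h (-p) (-q) = anisAlpha A D K h p q := by
  simp [anisAlpha]

theorem anisBeta_neg (p q : ℤ) : anisBeta A D K h (-p) (-q) = anisBeta A D K h p q := by
  simp [anisBeta]

theorem isHOCFamily_anis (hA : 0 < A) (hD : 2 * |D| < A) (hK : K ≤ 0) :
    IsHOCFamily ⟨A, D, A, 0, 0, K⟩ (anisAlpha A D K) (anisBeta A D K) := by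
  refine ⟨⟨1, one_pos, fun h _ _ => stencilSum_anisBeta hA hK⟩, 1, 1, one_pos, fun h hh _ =>
    ⟨fun p _ q _ => ⟨abs_anisBeta_le hA hD hK, ?_⟩, fun k l hkl => ?_⟩⟩
  · rw [anisBeta_neg, sub_self, abs_zero]
    positivity
  · rw [matchingResidual_anis hA hK hh hkl, abs_zero]
    positivity

theorem truncationBounds_anis (hA : 0 < A) (hD : 2 * |D| < A) (hK : K ≤ 0) (hh : 0 < h)
    {L : ℝ} (hL : h ≤ L) : TruncationBounds ⟨A, D, A, 0, 0, K⟩ (1 + 4 * A + -K * L ^ 2) h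
      (anisAlpha A D K h) (anisBeta A D K h) := by
  have hl := le_anis_denom (A := A) (h := h) hK
  have hl0 : 0 < 12 * A - K * h ^ 2 := by linarith
  have hKL : 0 ≤ -K * L ^ 2 := mul_nonneg (by linarith) (sq_nonneg L)
  have hKh : -K * h ^ 2 ≤ -K * L ^ 2 :=
    mul_le_mul_of_nonneg_left (pow_le_pow_left₀ hh.le hL 2) (by linarith)
  have hM : 0 ≤ (1 + 4 * A + -K * L ^ 2) * h ^ 4 := by positivity
  obtain ⟨d1, d2⟩ := abs_le.1 (le_refl |D|)
  refine ⟨fun p _ q _ => ?_, fun p _ q _ => (abs_anisBeta_le hA hD hK).trans (by linarith),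
    fun k l hkl => ?_, fun k l hkl => ?_, fun k l hkl => ?_⟩
  -- The denominator is at least `12 A`, so `4 A` covers the quadratic expressions in `A` and `D`,
  -- the largest being `40 A ^ 2` at the centre; `-K L ^ 2` covers the zeroth-order term there.
  · have hAl : 48 * A ^ 2 ≤ 4 * A * (12 * A - K * h ^ 2) := by nlinarith
    have hKl := mul_le_mul_of_nonneg_left hKh hl0.le
    have hKl' : 0 ≤ (12 * A - K * h ^ 2) * (-K * h ^ 2) :=
      mul_nonneg hl0.le (mul_nonneg (by linarith) (sq_nonneg h))
    have hDA : D ^ 2 ≤ A ^ 2 / 4 := by nlinarith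
    have hDA' : |A * D| ≤ A ^ 2 / 2 := by
      rw [abs_mul, abs_of_pos hA]
      nlinarith
    obtain ⟨e1, e2⟩ := abs_le.1 hDA'
    have hD0 := sq_nonneg D
    rw [anisAlpha, one_div_mul_eq_div, abs_div, abs_of_pos (mul_pos hl0 (pow_pos hh 2)), ← div_div,
      div_le_div_iff_of_pos_right (pow_pos hh 2), div_le_iff₀ hl0, abs_le]
    split_ifs <;> constructor <;> linarith
  · rw [moment_eq_zero_of_odd (fun p q => anisAlpha_neg p q) h (by rw [hkl]; decide), abs_zero]
    exact hM
  · rw [moment_eq_zero_of_odd (fun p q => anisBeta_neg p q) h (by rw [hkl]; decide), abs_zero]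
    exact hM
  · rw [matchingResidual_anis hA hK hh hkl, abs_zero]
    exact hM

/-- The row sum is exactly `K ≤ 0` and the first moment vanishes, so `γ = 1` and `ε = 0` suffice on
every grid; `δ` is the worst case `h = L` of the remaining term. -/
theorem stabilityBounds_anis (hA : 0 < A) (hD : 2 * |D| < A) (hK : K ≤ 0) (hh : 0 < h)
    {L : ℝ} (hL : h ≤ L) :
    StabilityBounds L 1 (1 / (1 + L) * (12 * A ^ 2 / (12 * A - K * L ^ 2))) 0 h
      (anisAlpha A D K h) := by
  have hl := le_anis_denom (A := A) (h := h) hK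
  have hl0 : 0 < 12 * A - K * h ^ 2 := by linarith
  obtain ⟨d1, d2⟩ := abs_le.1 (le_refl |D|)
  have m10 : moment (anisAlpha A D K h) h 1 0 = 0 := by
    simp [moment, stencilSum_eq, anisAlpha]
    ring
  have m20 : moment (anisAlpha A D K h) h 2 0 = 12 * A ^ 2 / (12 * A - K * h ^ 2) := by
    simp only [moment, anisAlpha]
    generalize 12 * A - K * h ^ 2 = lam at hl0
    simp [stencilSum_eq]
    field_simp
    ring
  have m00 : moment (anisAlpha A D K h) h 0 0 = K := by
    simp only [moment, anisAlpha]
    generalize 12 * A - K * h ^ 2 = lam at hl0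
    simp [stencilSum_eq]
    field_simp
    ring
  refine ⟨fun p _ q _ hpq => ?_, m00.trans_le hK, ?_⟩
  · rw [anisAlpha, if_neg hpq]
    refine mul_nonneg (by positivity) ?_
    split_ifs
    · nlinarith
    · nlinarith
    · nlinarith
  · rw [m10, m20]
    simp only [mul_zero, zero_mul, add_zero, one_mul]
    have hKh : -K * h ^ 2 ≤ -K * L ^ 2 :=
      mul_le_mul_of_nonneg_left (pow_le_pow_left₀ hh.le hL 2) (by linarith)
    have hL0 : 0 < 12 * A - K * L ^ 2 := by linarith
    gcongr ?_ * ?_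
    · exact one_div_le_one_div_of_le (by linarith) (by linarith)
    · exact div_le_div_of_nonneg_left (by positivity) hl0 (by linarith)

theorem fourthOrderAccurate_anis (hA : 0 < A) (hD : 2 * |D| < A) (hK : K ≤ 0) (xl yl : ℝ)
    {L : ℝ} (hL : 0 < L) : FourthOrderAccurate ⟨A, D, A, 0, 0, K⟩ xl yl L
      (anisAlpha A D K) (anisBeta A D K) := by
  intro f g u hu
  have hl0 : 0 < 12 * A - K * L ^ 2 := by
    have := le_anis_denom (A := A) (h := L) hK
    linarith
  obtain ⟨C, hC⟩ := hu.exists_fourthOrderOnGrid hL (1 + 4 * A + -K * L ^ 2) one_pos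
    (δ := 1 / (1 + L) * (12 * A ^ 2 / (12 * A - K * L ^ 2))) (by positivity) le_rfl
  refine ⟨C, fun N hN => ?_⟩
  have hN1 : (1 : ℝ) ≤ N := by exact_mod_cast hN
  have hh : 0 < L / N := by positivity
  have hhL : L / N ≤ L := div_le_self hL.le hN1
  exact hC N hN _ _ (truncationBounds_anis hA hD hK hh hhL) (stabilityBounds_anis hA hD hK hh hhL)

end Explicit

/-! ### Asymptotics of the moments of nearly consistent coefficients -/

/-- On the offsets `p ^ 3 = p` and `p ^ 4 = p ^ 2`; this and the next four identities differ only in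
the factorials. They are what allows the elimination of `α`. -/
theorem moment_three_zero (γ : Stencil) (h : ℝ) :
    moment γ h 3 0 = h ^ 2 / 6 * moment γ h 1 0 := by
  simp [moment, stencilSum_eq, Nat.factorial]; ring

theorem moment_zero_three (γ : Stencil) (h : ℝ) :
    moment γ h 0 3 = h ^ 2 / 6 * moment γ h 0 1 := by
  simp [moment, stencilSum_eq, Nat.factorial]; ring

theorem moment_three_one (γ : Stencil) (h : ℝ) :
    moment γ h 3 1 = h ^ 2 / 6 * moment γ h 1 1 := by
  simp [moment, stencilSum_eq, Nat.factorial]; ring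

theorem moment_four_zero (γ : Stencil) (h : ℝ) :
    moment γ h 4 0 = h ^ 2 / 12 * moment γ h 2 0 := by
  simp [moment, stencilSum_eq, Nat.factorial]; ring

theorem moment_zero_four (γ : Stencil) (h : ℝ) :
    moment γ h 0 4 = h ^ 2 / 12 * moment γ h 0 2 := by
  simp [moment, stencilSum_eq, Nat.factorial]; ring

theorem moment_zero_zero (γ : Stencil) (h : ℝ) : moment γ h 0 0 = stencilSum γ := by
  simp [moment, stencilSum_eq]

/-- The size of the moments of order one and two. -/
def momentSize (β : Stencil) (h : ℝ) : ℝ :=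
  |moment β h 1 0| + |moment β h 0 1| + |moment β h 2 0| + |moment β h 0 2| + |moment β h 1 1|

/-- A bound for the size of the coefficients of the equation. -/
def Coeffs.size (c : Coeffs) : ℝ := 1 + |c.A11| + 2 * |c.A12| + |c.a| + |c.b| + |c.K|

/-- The linear system is satisfied by normalized coefficients up to `O(h⁴)`. -/
structure NearlyConsistent (c : Coeffs) (M h : ℝ) (α β : Stencil) : Prop where
  normalized : stencilSum β = 1
  residual : ∀ k l, k + l ≤ 4 → |matchingResidual c h α β k l| ≤ M * h ^ 4

section

variable {c : Coeffs} {M h : ℝ} {α β : Stencil}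

theorem Coeffs.abs_mul_le (c : Coeffs) {t x S : ℝ}
    (ht : t = c.a ∨ t = c.b ∨ t = c.K ∨ t = 2 * c.A12 ∨ t = c.A11) (hx : |x| ≤ S) :
    |t * x| ≤ c.size * S := by
  rw [abs_mul]
  refine mul_le_mul ?_ hx (abs_nonneg _) ?_
  · have := abs_nonneg c.A11
    have := abs_nonneg c.A12
    have := abs_nonneg c.a
    have := abs_nonneg c.b
    have := abs_nonneg c.K
    have h2 : |2 * c.A12| = 2 * |c.A12| := by rw [abs_mul, abs_two]
    unfold Coeffs.size
    rcases ht with rfl | rfl | rfl | rfl | rfl <;> linarith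
  · unfold Coeffs.size
    positivity

theorem Coeffs.one_le_size (c : Coeffs) : 1 ≤ c.size := by
  have : 0 ≤ |c.A11| + 2 * |c.A12| + |c.a| + |c.b| + |c.K| := by positivity
  unfold Coeffs.size
  linarith

theorem NearlyConsistent.zero_le (hc : NearlyConsistent c M h α β) (hh : 0 < h) : 0 ≤ M := by
  have := (abs_nonneg _).trans (hc.residual 0 0 (by omega))
  exact nonneg_of_mul_nonneg_left this (by positivity)

theorem moment_le_momentSize (β : Stencil) (h : ℝ) :
    |moment β h 1 0| ≤ momentSize β h ∧ |moment β h 0 1| ≤ momentSize β h ∧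
    |moment β h 2 0| ≤ momentSize β h ∧ |moment β h 0 2| ≤ momentSize β h ∧
    |moment β h 1 1| ≤ momentSize β h := by
  have := abs_nonneg (moment β h 1 0)
  have := abs_nonneg (moment β h 0 1)
  have := abs_nonneg (moment β h 2 0)
  have := abs_nonneg (moment β h 0 2)
  have := abs_nonneg (moment β h 1 1)
  unfold momentSize
  refine ⟨?_, ?_, ?_, ?_, ?_⟩ <;> linarith

theorem abs_combination_le {h M r s : ℝ} (hh1 : h ≤ 1) (hh : 0 < h) {t : ℝ} (ht : 0 ≤ t)
    (ht1 : t ≤ 1) (hr : |r| ≤ M * h ^ 4) (hs : |s| ≤ M * h ^ 4) :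
    |r - h ^ 2 * t * s| ≤ 2 * M * h ^ 4 := by
  have h2 : h ^ 2 * t ≤ 1 := by
    have : h ^ 2 ≤ 1 := pow_le_one₀ hh.le hh1
    nlinarith [sq_nonneg h]
  have h2' : 0 ≤ h ^ 2 * t := by positivity
  calc |r - h ^ 2 * t * s| ≤ |r| + |h ^ 2 * t * s| := abs_sub _ _
    _ ≤ M * h ^ 4 + 1 * (M * h ^ 4) := by
      rw [abs_mul, abs_of_nonneg h2']
      exact add_le_add hr (mul_le_mul h2 hs (abs_nonneg _) zero_le_one)
    _ = _ := by ring

/-- The linear equations which eliminating `α` from the system gives for the moments of `β`. -/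
theorem NearlyConsistent.elimination (hc : NearlyConsistent c M h α β) (hA : c.A22 = c.A11)
    (hh : 0 < h) (hh1 : h ≤ 1) :
    |h ^ 2 / 12 * (c.A11 + c.a * moment β h 1 0 + c.K * moment β h 2 0)
      - c.A11 * moment β h 2 0| ≤ 2 * M * h ^ 4 ∧
    |h ^ 2 / 12 * (c.A11 + c.b * moment β h 0 1 + c.K * moment β h 0 2)
      - c.A11 * moment β h 0 2| ≤ 2 * M * h ^ 4 ∧
    |h ^ 2 / 6 * (c.a + c.K * moment β h 1 0)
      - (c.A11 * moment β h 1 0 + c.a * moment β h 2 0)| ≤ 2 * M * h ^ 4 ∧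
    |h ^ 2 / 6 * (c.b + c.K * moment β h 0 1)
      - (c.A11 * moment β h 0 1 + c.b * moment β h 0 2)| ≤ 2 * M * h ^ 4 ∧
    |h ^ 2 / 6 * (2 * c.A12 + c.b * moment β h 1 0 + c.a * moment β h 0 1 + c.K * moment β h 1 1)
      - (2 * c.A12 * moment β h 2 0 + c.A11 * moment β h 1 1)| ≤ 2 * M * h ^ 4 := by
  have h00 : moment β h 0 0 = 1 := by rw [moment_zero_zero, hc.normalized]
  have R := hc.residual
  -- In `R_40 - h²/12 R_20` the moments of `α` cancel, and likewise in the other four combinations,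
  -- with `1 / 6` for cubes.
  have e40 := abs_combination_le hh1 hh (t := 1 / 12) (by norm_num) (by norm_num)
    (R 4 0 (by omega)) (R 2 0 (by omega))
  have e04 := abs_combination_le hh1 hh (t := 1 / 12) (by norm_num) (by norm_num)
    (R 0 4 (by omega)) (R 0 2 (by omega))
  have e30 := abs_combination_le hh1 hh (t := 1 / 6) (by norm_num) (by norm_num)
    (R 3 0 (by omega)) (R 1 0 (by omega))
  have e03 := abs_combination_le hh1 hh (t := 1 / 6) (by norm_num) (by norm_num)
    (R 0 3 (by omega)) (R 0 1 (by omega))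
  have e31 := abs_combination_le hh1 hh (t := 1 / 6) (by norm_num) (by norm_num)
    (R 3 1 (by omega)) (R 1 1 (by omega))
  simp [matchingResidual, pdeCoeff, Finset.sum_range_succ, h00, hA, moment_four_zero,
    moment_zero_four, moment_three_zero, moment_zero_three, moment_three_one]
    at e40 e04 e30 e03 e31
  refine ⟨?_, ?_, ?_, ?_, ?_⟩
  · convert e40 using 2; ring
  · convert e04 using 2; ring
  · convert e30 using 2; ring
  · convert e03 using 2; ring
  · convert e31 using 2; ring

/-- The eliminated equations bound the size `S` of the moments by `Q h² (1 + S)`; for small `h` the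
right-hand `S` is absorbed. -/
theorem exists_momentSize_le (c : Coeffs) (hA : c.A22 = c.A11) (hA0 : 0 < c.A11) (M : ℝ) :
    ∃ C h₁ : ℝ, 0 < h₁ ∧ ∀ (h : ℝ) (α β : Stencil), 0 < h → h ≤ h₁ →
      NearlyConsistent c M h α β → momentSize β h ≤ C * h ^ 2 := by
  set D := c.size + |M| with hD
  have hD1 : 1 ≤ D := by have := c.one_le_size; have := abs_nonneg M; linarith
  -- Five moments contribute `3 D` each; the three moments `(1,0)`, `(0,1)`, `(1,1)` involve in
  -- addition a pure second moment, already bounded by `3 D / A11`, times `D`.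
  set Q := (15 * D + 9 * D ^ 2 / c.A11) / c.A11 with hQ
  have hQ0 : 0 < Q := by positivity
  refine ⟨2 * Q, min 1 (1 / (2 * Q)), by positivity, fun h α β hh hh1 hc => ?_⟩
  have hle1 : h ≤ 1 := hh1.trans (min_le_left _ _)
  have hQh : Q * h ^ 2 ≤ 1 / 2 := by
    have h1 : h ≤ 1 / (2 * Q) := hh1.trans (min_le_right _ _)
    rw [le_div_iff₀ (by positivity)] at h1
    nlinarith
  have hM := hc.zero_le hh
  have hMD : M ≤ D := by have := c.one_le_size; have := le_abs_self M; linarith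
  obtain ⟨e20, e02, e10, e01, e11⟩ := hc.elimination hA hh hle1
  obtain ⟨s10, s01, s20, s02, s11⟩ := moment_le_momentSize β h
  have hS0 : 0 ≤ momentSize β h := (abs_nonneg _).trans s10
  set S := momentSize β h with hS
  have hh42 : M * h ^ 4 ≤ D * h ^ 2 := by
    have : h ^ 4 ≤ h ^ 2 := pow_le_pow_of_le_one hh.le hle1 (by norm_num)
    exact mul_le_mul hMD this (by positivity) (by positivity)
  have small : ∀ {t x S : ℝ}, (t = c.a ∨ t = c.b ∨ t = c.K ∨ t = 2 * c.A12 ∨ t = c.A11) →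
      |x| ≤ S → |t * x| ≤ D * S := by
    intro t x S ht hx
    refine (c.abs_mul_le ht hx).trans (mul_le_mul_of_nonneg_right ?_ ((abs_nonneg _).trans hx))
    have := abs_nonneg M
    linarith
  have smallh : ∀ {t x S : ℝ}, (t = c.a ∨ t = c.b ∨ t = c.K ∨ t = 2 * c.A12 ∨ t = c.A11) →
      |x| ≤ S → |h ^ 2 * (t * x)| ≤ D * S * h ^ 2 := by
    intro t x S ht hx
    rw [abs_mul, abs_of_nonneg (sq_nonneg h), mul_comm]
    exact mul_le_mul_of_nonneg_right (small ht hx) (sq_nonneg h)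
  have one1 : |(1 : ℝ)| ≤ 1 := by simp
  have hSh : 0 ≤ D * S * h ^ 2 := by positivity
  have hDh : 0 ≤ D * h ^ 2 := by positivity
  have absA : ∀ x, c.A11 * |x| = |c.A11 * x| := fun x => by rw [abs_mul, abs_of_pos hA0]
  have f20 : c.A11 * |moment β h 2 0| ≤ 3 * D * h ^ 2 * (1 + S) := by
    rw [absA, abs_le]
    have a1 := abs_le.1 (smallh (t := c.A11) (by simp) one1)
    have a2 := abs_le.1 (smallh (t := c.a) (by simp) s10)
    have a3 := abs_le.1 (smallh (t := c.K) (by simp) s20)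
    have a4 := abs_le.1 e20
    constructor <;> linarith [a1.1, a1.2, a2.1, a2.2, a3.1, a3.2, a4.1, a4.2]
  have f02 : c.A11 * |moment β h 0 2| ≤ 3 * D * h ^ 2 * (1 + S) := by
    rw [absA, abs_le]
    have a1 := abs_le.1 (smallh (t := c.A11) (by simp) one1)
    have a2 := abs_le.1 (smallh (t := c.b) (by simp) s01)
    have a3 := abs_le.1 (smallh (t := c.K) (by simp) s02)
    have a4 := abs_le.1 e02
    constructor <;> linarith [a1.1, a1.2, a2.1, a2.2, a3.1, a3.2, a4.1, a4.2]
  have f10 : c.A11 * |moment β h 1 0| ≤ D * |moment β h 2 0| + 3 * D * h ^ 2 * (1 + S) := by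
    rw [absA, abs_le]
    have a1 := abs_le.1 (smallh (t := c.a) (by simp) one1)
    have a2 := abs_le.1 (smallh (t := c.K) (by simp) s10)
    have a3 := abs_le.1 (small (t := c.a) (by simp) (le_refl |moment β h 2 0|))
    have a4 := abs_le.1 e10
    constructor <;> linarith [a1.1, a1.2, a2.1, a2.2, a3.1, a3.2, a4.1, a4.2]
  have f01 : c.A11 * |moment β h 0 1| ≤ D * |moment β h 0 2| + 3 * D * h ^ 2 * (1 + S) := by
    rw [absA, abs_le]
    have a1 := abs_le.1 (smallh (t := c.b) (by simp) one1)
    have a2 := abs_le.1 (smallh (t := c.K) (by simp) s01)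
    have a3 := abs_le.1 (small (t := c.b) (by simp) (le_refl |moment β h 0 2|))
    have a4 := abs_le.1 e01
    constructor <;> linarith [a1.1, a1.2, a2.1, a2.2, a3.1, a3.2, a4.1, a4.2]
  have f11 : c.A11 * |moment β h 1 1| ≤ D * |moment β h 2 0| + 3 * D * h ^ 2 * (1 + S) := by
    rw [absA, abs_le]
    have a1 := abs_le.1 (smallh (t := 2 * c.A12) (by simp) one1)
    have a2 := abs_le.1 (smallh (t := c.b) (by simp) s10)
    have a2' := abs_le.1 (smallh (t := c.a) (by simp) s01)
    have a2'' := abs_le.1 (smallh (t := c.K) (by simp) s11)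
    have a3 := abs_le.1 (small (t := 2 * c.A12) (by simp) (le_refl |moment β h 2 0|))
    have a4 := abs_le.1 e11
    constructor <;> linarith [a1.1, a1.2, a2.1, a2.2, a3.1, a3.2, a4.1, a4.2, a2'.1, a2'.2,
      a2''.1, a2''.2]
  have g : ∀ {x : ℝ}, c.A11 * x ≤ 3 * D * h ^ 2 * (1 + S) →
      D * x ≤ 3 * D ^ 2 / c.A11 * (h ^ 2 * (1 + S)) := by
    intro x hx
    calc D * x = D / c.A11 * (c.A11 * x) := by field_simp
      _ ≤ D / c.A11 * (3 * D * h ^ 2 * (1 + S)) :=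
        mul_le_mul_of_nonneg_left hx (by positivity)
      _ = _ := by ring
  have g20 := g f20
  have g02 := g f02
  have hfin : c.A11 * S ≤ c.A11 * (Q * h ^ 2 * (1 + S)) := by
    have e1 : c.A11 * (Q * h ^ 2 * (1 + S))
        = 15 * (D * h ^ 2 * (1 + S)) + 3 * (3 * D ^ 2 / c.A11 * (h ^ 2 * (1 + S))) := by
      rw [hQ]; field_simp; ring
    have e2 : c.A11 * S = c.A11 * |moment β h 1 0| + c.A11 * |moment β h 0 1|
        + c.A11 * |moment β h 2 0| + c.A11 * |moment β h 0 2| + c.A11 * |moment β h 1 1| := by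
      rw [show S = |moment β h 1 0| + |moment β h 0 1| + |moment β h 2 0| + |moment β h 0 2|
        + |moment β h 1 1| from rfl]
      ring
    rw [e1, e2]
    linarith only [f20, f02, f10, f01, f11, g20, g02]
  have hfin' := le_of_mul_le_mul_left hfin hA0
  nlinarith

/-- Leading terms of the moments of the coefficients of `f`. -/
structure BetaMoments (c : Coeffs) (C h : ℝ) (β : Stencil) : Prop where
  size : momentSize β h ≤ C * h ^ 2
  m20 : |moment β h 2 0 - h ^ 2 / 12| ≤ C * h ^ 4
  m02 : |moment β h 0 2 - h ^ 2 / 12| ≤ C * h ^ 4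
  m11 : |moment β h 1 1 - h ^ 2 * (c.A12 / (6 * c.A11))| ≤ C * h ^ 4

theorem Coeffs.abs_mul_le_of_size (c : Coeffs) {M C h t x : ℝ}
    (ht : t = c.a ∨ t = c.b ∨ t = c.K ∨ t = 2 * c.A12 ∨ t = c.A11) (hx : |x| ≤ C * h ^ 2) :
    |t * x| ≤ (|M| + c.size * C) * h ^ 2 := by
  refine (c.abs_mul_le ht hx).trans ?_
  rw [← mul_assoc]
  exact mul_le_mul_of_nonneg_right (by linarith [abs_nonneg M]) (sq_nonneg h)

/-- A second pass through the eliminated equations: with all moments now `O(h²)`, the terms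
multiplied by `h² a`, `h² b`, `h² K` are `O(h⁴)` and the leading parts can be read off. The mixed
moment uses the result for `(2,0)`. -/
theorem exists_betaMoments (c : Coeffs) (hA : c.A22 = c.A11) (hA0 : 0 < c.A11) (M : ℝ) :
    ∃ C h₁ : ℝ, 0 ≤ C ∧ 0 < h₁ ∧ h₁ ≤ 1 ∧ ∀ (h : ℝ) (α β : Stencil), 0 < h → h ≤ h₁ →
      NearlyConsistent c M h α β → BetaMoments c C h β := by
  obtain ⟨C₀, h₁, hh₁, hC⟩ := exists_momentSize_le c hA hA0 M
  set D := c.size with hD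
  have hD1 : 1 ≤ D := c.one_le_size
  set P := |M| + D * |C₀| with hP
  have hP0 : 0 ≤ P := by positivity
  set E := 10 * P / c.A11 with hE
  have hE0 : 0 ≤ E := by positivity
  set E' := (10 * P + D * E) / c.A11 with hE'
  have hE0' : 0 ≤ E' := by positivity
  refine ⟨|C₀| + E + E', min 1 h₁, by positivity, by positivity, min_le_left _ _,
    fun h α β hh hhle hc => ?_⟩
  have hle1 : h ≤ 1 := hhle.trans (min_le_left _ _)
  have hM := hc.zero_le hh
  obtain ⟨e20, e02, -, -, e11⟩ := hc.elimination hA hh hle1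
  obtain ⟨s10, s01, s20, s02, s11⟩ := moment_le_momentSize β h
  have hS : momentSize β h ≤ |C₀| * h ^ 2 :=
    (hC h α β hh (hhle.trans (min_le_right _ _)) hc).trans
      (mul_le_mul_of_nonneg_right (le_abs_self _) (sq_nonneg h))
  replace s10 := s10.trans hS
  replace s01 := s01.trans hS
  replace s20 := s20.trans hS
  replace s02 := s02.trans hS
  replace s11 := s11.trans hS
  have smallh : ∀ {t x : ℝ}, (t = c.a ∨ t = c.b ∨ t = c.K ∨ t = 2 * c.A12 ∨ t = c.A11) →
      |x| ≤ |C₀| * h ^ 2 → |h ^ 2 * (t * x)| ≤ P * h ^ 4 := by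
    intro t x ht hx
    rw [abs_mul, abs_of_nonneg (sq_nonneg h)]
    calc _ ≤ h ^ 2 * (P * h ^ 2) := mul_le_mul_of_nonneg_left
          (c.abs_mul_le_of_size ht hx) (sq_nonneg h)
      _ = _ := by ring
  have hMP : M * h ^ 4 ≤ P * h ^ 4 := by
    refine mul_le_mul_of_nonneg_right ?_ (by positivity)
    have : 0 ≤ D * |C₀| := by positivity
    linarith [le_abs_self M]
  have divA : ∀ {x B : ℝ}, |c.A11 * x| ≤ B * h ^ 4 → |x| ≤ B / c.A11 * h ^ 4 := by
    intro x B hx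
    rw [abs_mul, abs_of_pos hA0] at hx
    rw [div_mul_eq_mul_div, le_div_iff₀ hA0]
    linarith
  have hPh : 0 ≤ P * h ^ 4 := by positivity
  have d20 : |moment β h 2 0 - h ^ 2 / 12| ≤ E * h ^ 4 := by
    refine divA ?_
    have a2 := abs_le.1 (smallh (t := c.a) (by simp) s10)
    have a3 := abs_le.1 (smallh (t := c.K) (by simp) s20)
    have a4 := abs_le.1 e20
    rw [abs_le]
    constructor <;> linarith only [a2.1, a2.2, a3.1, a3.2, a4.1, a4.2, hMP, hPh]
  have d02 : |moment β h 0 2 - h ^ 2 / 12| ≤ E * h ^ 4 := by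
    refine divA ?_
    have a2 := abs_le.1 (smallh (t := c.b) (by simp) s01)
    have a3 := abs_le.1 (smallh (t := c.K) (by simp) s02)
    have a4 := abs_le.1 e02
    rw [abs_le]
    constructor <;> linarith only [a2.1, a2.2, a3.1, a3.2, a4.1, a4.2, hMP, hPh]
  have d11 : |moment β h 1 1 - h ^ 2 * (c.A12 / (6 * c.A11))| ≤ E' * h ^ 4 := by
    refine divA ?_
    have a1 := abs_le.1 (c.abs_mul_le (t := 2 * c.A12) (by simp) d20)
    have a2 := abs_le.1 (smallh (t := c.b) (by simp) s10)
    have a2' := abs_le.1 (smallh (t := c.a) (by simp) s01)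
    have a3 := abs_le.1 (smallh (t := c.K) (by simp) s11)
    have a4 := abs_le.1 e11
    have hid : c.A11 * (moment β h 1 1 - h ^ 2 * (c.A12 / (6 * c.A11)))
        = c.A11 * moment β h 1 1 - h ^ 2 * c.A12 / 6 := by field_simp
    rw [← hD] at a1
    rw [hid, abs_le]
    constructor <;> linarith only [a1.1, a1.2, a2.1, a2.2, a2'.1, a2'.2, a3.1, a3.2, a4.1, a4.2,
      hMP, hPh]
  refine ⟨hS.trans ?_, d20.trans ?_, d02.trans ?_, d11.trans ?_⟩
  · gcongr; linarith
  · gcongr; linarith [abs_nonneg C₀]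
  · gcongr; linarith [abs_nonneg C₀]
  · gcongr; linarith [abs_nonneg C₀]

/-- Leading terms of the moments of the coefficients of `U`. -/
structure AlphaMoments (c : Coeffs) (C h : ℝ) (α : Stencil) : Prop where
  m00 : |moment α h 0 0 - c.K| ≤ C * h
  m10 : |moment α h 1 0| ≤ C
  m01 : |moment α h 0 1| ≤ C
  m11 : |moment α h 1 1 - 2 * c.A12| ≤ C * h
  m20 : |moment α h 2 0 - c.A11| ≤ C * h
  m02 : |moment α h 0 2 - c.A11| ≤ C * h
  m21 : |moment α h 2 1| ≤ C * h ^ 2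
  m12 : |moment α h 1 2| ≤ C * h ^ 2
  m22 : |moment α h 2 2 - h ^ 2 * (c.A11 / 6 + c.A12 ^ 2 / (3 * c.A11))| ≤ C * h ^ 3

/-- Each residual expresses a moment of `α` by moments of `β`, up to `O(h⁴)`. The moment `(2,2)` is
needed to leading order because it enters every coefficient at the same order as `h²` times the
second moments. -/
theorem exists_alphaMoments (c : Coeffs) (hA : c.A22 = c.A11) (hA0 : 0 < c.A11) (M : ℝ) :
    ∃ C h₁ : ℝ, 0 < h₁ ∧ h₁ ≤ 1 ∧ ∀ (h : ℝ) (α β : Stencil), 0 < h → h ≤ h₁ →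
      NearlyConsistent c M h α β → AlphaMoments c C h α := by
  obtain ⟨C, h₁, hC0, hh₁, hh₁', hC⟩ := exists_betaMoments c hA hA0 M
  set D := c.size with hD
  have hD1 : 1 ≤ D := c.one_le_size
  set P := |M| + D * C with hP
  have hDC : 0 ≤ D * C := by positivity
  have hP0 : 0 ≤ P := by positivity
  refine ⟨5 * P + D, h₁, hh₁, hh₁', fun h α β hh hhle hc => ?_⟩
  have hle1 : h ≤ 1 := hhle.trans hh₁'
  have hM := hc.zero_le hh
  obtain ⟨hS, d20, d02, d11⟩ := hC h α β hh hhle hc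
  obtain ⟨s10, s01, s20, s02, s11⟩ := moment_le_momentSize β h
  replace s10 := s10.trans hS
  replace s01 := s01.trans hS
  replace s20 := s20.trans hS
  replace s02 := s02.trans hS
  replace s11 := s11.trans hS
  have small : ∀ {t x : ℝ}, (t = c.a ∨ t = c.b ∨ t = c.K ∨ t = 2 * c.A12 ∨ t = c.A11) →
      |x| ≤ C * h ^ 2 → |t * x| ≤ P * h ^ 2 := fun ht hx => c.abs_mul_le_of_size ht hx
  have mono : ∀ {X : ℝ}, 0 ≤ X → X * h ^ 4 ≤ X * h ^ 3 ∧ X * h ^ 3 ≤ X * h ^ 2 ∧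
      X * h ^ 2 ≤ X * h ∧ X * h ≤ X := by
    intro X hX
    refine ⟨?_, ?_, ?_, ?_⟩
    · exact mul_le_mul_of_nonneg_left (pow_le_pow_of_le_one hh.le hle1 (by norm_num)) hX
    · exact mul_le_mul_of_nonneg_left (pow_le_pow_of_le_one hh.le hle1 (by norm_num)) hX
    · exact mul_le_mul_of_nonneg_left (pow_le_of_le_one hh.le hle1 (by norm_num)) hX
    · exact mul_le_of_le_one_right hX hle1
  have hMP : M * h ^ 4 ≤ P * h ^ 4 :=
    mul_le_mul_of_nonneg_right (by linarith [le_abs_self M]) (by positivity)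
  have hDCP : D * C * h ^ 4 ≤ P * h ^ 4 :=
    mul_le_mul_of_nonneg_right (by linarith [abs_nonneg M]) (by positivity)
  obtain ⟨p1, p2, p3, p4⟩ := mono hP0
  have hD0 : 0 ≤ D := zero_le_one.trans hD1
  have q1 : 0 ≤ D * h := by positivity
  have q2 : 0 ≤ D * h ^ 2 := by positivity
  have q3 : 0 ≤ D * h ^ 3 := by positivity
  have hPh : 0 ≤ P * h ^ 4 := by positivity
  have h00 : moment β h 0 0 = 1 := by rw [moment_zero_zero, hc.normalized]
  have R := hc.residual
  refine ⟨?_, ?_, ?_, ?_, ?_, ?_, ?_, ?_, ?_⟩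
  · have r := R 0 0 (by omega)
    simp [matchingResidual, pdeCoeff, Finset.sum_range_succ, h00] at r
    rw [abs_le] at r ⊢
    constructor <;> linarith only [r.1, r.2, hMP, p1, p2, p3, q1, hPh]
  · have r := R 1 0 (by omega)
    simp [matchingResidual, pdeCoeff, Finset.sum_range_succ, h00] at r
    have da := abs_le.1 (c.abs_mul_le (t := c.a) (x := 1) (S := 1) (by simp) (by simp))
    have k10 := abs_le.1 (small (t := c.K) (by simp) s10)
    rw [← hD] at da
    rw [abs_le] at r ⊢
    constructor <;> linarith only [r.1, r.2, da.1, da.2, k10.1, k10.2, hMP, p1, p2, p3, p4, hP0]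
  · have r := R 0 1 (by omega)
    simp [matchingResidual, pdeCoeff, Finset.sum_range_succ, h00] at r
    have da := abs_le.1 (c.abs_mul_le (t := c.b) (x := 1) (S := 1) (by simp) (by simp))
    have k10 := abs_le.1 (small (t := c.K) (by simp) s01)
    rw [← hD] at da
    rw [abs_le] at r ⊢
    constructor <;> linarith only [r.1, r.2, da.1, da.2, k10.1, k10.2, hMP, p1, p2, p3, p4, hP0]
  · have r := R 1 1 (by omega)
    simp [matchingResidual, pdeCoeff, Finset.sum_range_succ, h00] at r
    have x1 := abs_le.1 (small (t := c.b) (by simp) s10)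
    have x2 := abs_le.1 (small (t := c.a) (by simp) s01)
    have x3 := abs_le.1 (small (t := c.K) (by simp) s11)
    rw [abs_le] at r ⊢
    constructor <;> linarith only [r.1, r.2, x1.1, x1.2, x2.1, x2.2, x3.1, x3.2, hMP, p1, p2, p3,
      q1, hPh]
  · have r := R 2 0 (by omega)
    simp [matchingResidual, pdeCoeff, Finset.sum_range_succ, h00] at r
    have x1 := abs_le.1 (small (t := c.a) (by simp) s10)
    have x2 := abs_le.1 (small (t := c.K) (by simp) s20)
    rw [abs_le] at r ⊢
    constructor <;> linarith only [r.1, r.2, x1.1, x1.2, x2.1, x2.2, hMP, p1, p2, p3, q1, hPh]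
  · have r := R 0 2 (by omega)
    simp [matchingResidual, pdeCoeff, Finset.sum_range_succ, h00, hA] at r
    have x1 := abs_le.1 (small (t := c.b) (by simp) s01)
    have x2 := abs_le.1 (small (t := c.K) (by simp) s02)
    rw [abs_le] at r ⊢
    constructor <;> linarith only [r.1, r.2, x1.1, x1.2, x2.1, x2.2, hMP, p1, p2, p3, q1, hPh]
  · have r := R 2 1 (by omega)
    simp [matchingResidual, pdeCoeff, Finset.sum_range_succ] at r
    have x1 := abs_le.1 (small (t := c.A11) (by simp) s01)
    have x2 := abs_le.1 (small (t := 2 * c.A12) (by simp) s10)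
    have x3 := abs_le.1 (small (t := c.a) (by simp) s11)
    have x4 := abs_le.1 (small (t := c.b) (by simp) s20)
    rw [abs_le] at r ⊢
    constructor <;> linarith only [r.1, r.2, x1.1, x1.2, x2.1, x2.2, x3.1, x3.2, x4.1, x4.2, hMP,
      p1, p2, q2, hPh]
  · have r := R 1 2 (by omega)
    simp [matchingResidual, pdeCoeff, Finset.sum_range_succ, hA] at r
    have x1 := abs_le.1 (small (t := c.A11) (by simp) s10)
    have x2 := abs_le.1 (small (t := 2 * c.A12) (by simp) s01)
    have x3 := abs_le.1 (small (t := c.a) (by simp) s02)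
    have x4 := abs_le.1 (small (t := c.b) (by simp) s11)
    rw [abs_le] at r ⊢
    constructor <;> linarith only [r.1, r.2, x1.1, x1.2, x2.1, x2.2, x3.1, x3.2, x4.1, x4.2, hMP,
      p1, p2, q2, hPh]
  · have r := R 2 2 (by omega)
    simp [matchingResidual, pdeCoeff, Finset.sum_range_succ, hA] at r
    have u1 := abs_le.1 (c.abs_mul_le (t := 2 * c.A12) (by simp) d11)
    have u2 := abs_le.1 (c.abs_mul_le (t := c.A11) (by simp) d20)
    have u3 := abs_le.1 (c.abs_mul_le (t := c.A11) (by simp) d02)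
    rw [← hD, ← mul_assoc] at u1 u2 u3
    have hid : h ^ 2 * (c.A11 / 6 + c.A12 ^ 2 / (3 * c.A11))
        = c.A11 * (h ^ 2 / 12) + c.A11 * (h ^ 2 / 12)
          + 2 * c.A12 * (h ^ 2 * (c.A12 / (6 * c.A11))) := by
      field_simp
      ring
    rw [hid]
    rw [abs_le] at r ⊢
    constructor <;> linarith only [r.1, r.2, u1.1, u1.2, u2.1, u2.2, u3.1, u3.2, hMP, hDCP, p1,
      q3, hPh]

end

/-! ### Convergence of HOC families -/

theorem mem_offsets_iff {p : ℤ} : p ∈ offsets ↔ p = -1 ∨ p = 0 ∨ p = 1 := by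
  simp only [offsets, Finset.mem_Icc]
  omega

/-- The nine moments with `k, l ≤ 2` determine a nine-point stencil; this and the next three
identities are the inverse formulas. -/
theorem corner_eq_moments (α : Stencil) {h : ℝ} (hh : h ≠ 0) {p q : ℤ} (hp : p = -1 ∨ p = 1)
    (hq : q = -1 ∨ q = 1) :
    4 * (h ^ 4 * α p q) = p * q * (h ^ 2 * moment α h 1 1) + 4 * moment α h 2 2
      + 2 * h * (p * moment α h 1 2 + q * moment α h 2 1) := by
  rcases hp with rfl | rfl <;> rcases hq with rfl | rfl <;>
    simp [moment, stencilSum_eq] <;> field_simp <;> ring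

theorem horizontal_eq_moments (α : Stencil) {h : ℝ} (hh : h ≠ 0) {p : ℤ} (hp : p = -1 ∨ p = 1) :
    2 * (h ^ 4 * α p 0) = p * (h ^ 3 * moment α h 1 0) + 2 * (h ^ 2 * moment α h 2 0)
      - 2 * h * (p * moment α h 1 2) - 4 * moment α h 2 2 := by
  rcases hp with rfl | rfl <;> simp [moment, stencilSum_eq] <;> field_simp <;> ring

theorem vertical_eq_moments (α : Stencil) {h : ℝ} (hh : h ≠ 0) {q : ℤ} (hq : q = -1 ∨ q = 1) :
    2 * (h ^ 4 * α 0 q) = q * (h ^ 3 * moment α h 0 1) + 2 * (h ^ 2 * moment α h 0 2)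
      - 2 * h * (q * moment α h 2 1) - 4 * moment α h 2 2 := by
  rcases hq with rfl | rfl <;> simp [moment, stencilSum_eq] <;> field_simp <;> ring

theorem center_eq_moments (α : Stencil) {h : ℝ} (hh : h ≠ 0) :
    h ^ 4 * α 0 0 = h ^ 4 * moment α h 0 0 - 2 * (h ^ 2 * moment α h 2 0)
      - 2 * (h ^ 2 * moment α h 0 2) + 4 * moment α h 2 2 := by
  simp [moment, stencilSum_eq]
  field_simp
  ring

theorem abs_sign_mul_le {p : ℤ} (hp : p = -1 ∨ p = 1) {x B : ℝ} (hx : |x| ≤ B) :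
    |(p : ℝ) * x| ≤ B := by
  rcases hp with rfl | rfl <;> simpa using hx

section

variable {c : Coeffs} {C h : ℝ} {α : Stencil}

theorem AlphaMoments.nonneg (hm : AlphaMoments c C h α) : 0 ≤ C :=
  (abs_nonneg _).trans hm.m10

theorem AlphaMoments.corner (hm : AlphaMoments c C h α) (hh : 0 < h) {p q : ℤ}
    (hp : p = -1 ∨ p = 1) (hq : q = -1 ∨ q = 1) :
    |4 * (h ^ 4 * α p q) - h ^ 2 * (2 * (p * q * c.A12)
      + 4 * (c.A11 / 6 + c.A12 ^ 2 / (3 * c.A11)))| ≤ 9 * C * h ^ 3 := by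
  rw [corner_eq_moments α hh.ne' hp hq]
  have h1 := abs_le.1 (abs_sign_mul_le hp (abs_sign_mul_le hq hm.m11))
  have h1' := mul_le_mul_of_nonneg_left h1.1 (sq_nonneg h)
  have h1'' := mul_le_mul_of_nonneg_left h1.2 (sq_nonneg h)
  have h2 := abs_le.1 (abs_sign_mul_le hp hm.m12)
  have h2' := mul_le_mul_of_nonneg_left h2.1 hh.le
  have h2'' := mul_le_mul_of_nonneg_left h2.2 hh.le
  have h3 := abs_le.1 (abs_sign_mul_le hq hm.m21)
  have h3' := mul_le_mul_of_nonneg_left h3.1 hh.le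
  have h3'' := mul_le_mul_of_nonneg_left h3.2 hh.le
  have h4 := abs_le.1 hm.m22
  rw [abs_le]
  constructor <;> linarith only [h1', h1'', h2', h2'', h3', h3'', h4.1, h4.2]

theorem AlphaMoments.horizontal (hm : AlphaMoments c C h α) (hh : 0 < h) {p : ℤ}
    (hp : p = -1 ∨ p = 1) :
    |2 * (h ^ 4 * α p 0) - h ^ 2 * (2 * c.A11
      - 4 * (c.A11 / 6 + c.A12 ^ 2 / (3 * c.A11)))| ≤ 9 * C * h ^ 3 := by
  rw [horizontal_eq_moments α hh.ne' hp]
  have h1 := abs_le.1 (abs_sign_mul_le hp hm.m10)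
  have h1' := mul_le_mul_of_nonneg_left h1.1 (pow_pos hh 3).le
  have h1'' := mul_le_mul_of_nonneg_left h1.2 (pow_pos hh 3).le
  have h2 := abs_le.1 (abs_sign_mul_le hp hm.m12)
  have h2' := mul_le_mul_of_nonneg_left h2.1 hh.le
  have h2'' := mul_le_mul_of_nonneg_left h2.2 hh.le
  have h3 := abs_le.1 hm.m20
  have h3' := mul_le_mul_of_nonneg_left h3.1 (sq_nonneg h)
  have h3'' := mul_le_mul_of_nonneg_left h3.2 (sq_nonneg h)
  have h4 := abs_le.1 hm.m22
  rw [abs_le]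
  constructor <;> linarith only [h1', h1'', h2', h2'', h3', h3'', h4.1, h4.2]

theorem AlphaMoments.vertical (hm : AlphaMoments c C h α) (hh : 0 < h) {q : ℤ}
    (hq : q = -1 ∨ q = 1) :
    |2 * (h ^ 4 * α 0 q) - h ^ 2 * (2 * c.A11
      - 4 * (c.A11 / 6 + c.A12 ^ 2 / (3 * c.A11)))| ≤ 9 * C * h ^ 3 := by
  rw [vertical_eq_moments α hh.ne' hq]
  have h1 := abs_le.1 (abs_sign_mul_le hq hm.m01)
  have h1' := mul_le_mul_of_nonneg_left h1.1 (pow_pos hh 3).le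
  have h1'' := mul_le_mul_of_nonneg_left h1.2 (pow_pos hh 3).le
  have h2 := abs_le.1 (abs_sign_mul_le hq hm.m21)
  have h2' := mul_le_mul_of_nonneg_left h2.1 hh.le
  have h2'' := mul_le_mul_of_nonneg_left h2.2 hh.le
  have h3 := abs_le.1 hm.m02
  have h3' := mul_le_mul_of_nonneg_left h3.1 (sq_nonneg h)
  have h3'' := mul_le_mul_of_nonneg_left h3.2 (sq_nonneg h)
  have h4 := abs_le.1 hm.m22
  rw [abs_le]
  constructor <;> linarith only [h1', h1'', h2', h2'', h3', h3'', h4.1, h4.2]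

theorem AlphaMoments.center (hm : AlphaMoments c C h α) (hh : 0 < h) (hh1 : h ≤ 1) :
    |h ^ 4 * α 0 0 - h ^ 2 * (h ^ 2 * c.K - 4 * c.A11
      + 4 * (c.A11 / 6 + c.A12 ^ 2 / (3 * c.A11)))| ≤ 9 * C * h ^ 3 := by
  rw [center_eq_moments α hh.ne']
  have h1 := abs_le.1 hm.m00
  have h1' := mul_le_mul_of_nonneg_left h1.1 (pow_pos hh 4).le
  have h1'' := mul_le_mul_of_nonneg_left h1.2 (pow_pos hh 4).le
  have h2 := abs_le.1 hm.m20
  have h2' := mul_le_mul_of_nonneg_left h2.1 (sq_nonneg h)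
  have h2'' := mul_le_mul_of_nonneg_left h2.2 (sq_nonneg h)
  have h3 := abs_le.1 hm.m02
  have h3' := mul_le_mul_of_nonneg_left h3.1 (sq_nonneg h)
  have h3'' := mul_le_mul_of_nonneg_left h3.2 (sq_nonneg h)
  have h4 := abs_le.1 hm.m22
  have h5 : C * h ^ 5 ≤ C * h ^ 3 := mul_le_mul_of_nonneg_left
    (pow_le_pow_of_le_one hh.le hh1 (by norm_num)) (hm.nonneg)
  rw [abs_le]
  constructor <;> linarith only [h1', h1'', h2', h2'', h3', h3'', h4.1, h4.2, h5]

/-- The smallest limit of the scaled off-centre coefficients. -/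
theorem exists_coefficient_gap (c : Coeffs) (hc : 2 * |c.A12| < c.A11) :
    ∃ η : ℝ, 0 < η ∧
      (∀ s : ℝ, |s| = 1 → η ≤ 2 * (s * c.A12) + 4 * (c.A11 / 6 + c.A12 ^ 2 / (3 * c.A11))) ∧
      η ≤ 2 * c.A11 - 4 * (c.A11 / 6 + c.A12 ^ 2 / (3 * c.A11)) := by
  have hA0 : 0 < c.A11 := by linarith [abs_nonneg c.A12]
  set D := |c.A12| with hD
  have hD0 : 0 ≤ D := abs_nonneg _
  have hsq : c.A12 ^ 2 = D ^ 2 := (sq_abs _).symm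
  -- The limit at the corners where `s A12 = -|A12|`. The edge limit is `4 (A11 ^ 2 - D ^ 2) / (3
  -- A11)`, which is larger.
  refine ⟨2 * (c.A11 - D) * (c.A11 - 2 * D) / (3 * c.A11), ?_, fun s hs => ?_, ?_⟩
  · have : 0 < c.A11 - D := by linarith
    have : 0 < c.A11 - 2 * D := by linarith
    positivity
  · have h1 : -D ≤ s * c.A12 := by
      have := (abs_le.1 (le_refl |s * c.A12|)).1
      rwa [abs_mul, hs, one_mul] at this
    have e : 2 * (c.A11 - D) * (c.A11 - 2 * D) / (3 * c.A11)
        = 2 * (-D) + 4 * (c.A11 / 6 + D ^ 2 / (3 * c.A11)) := by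
      field_simp
      ring
    rw [e, hsq]
    linarith
  · rw [hsq, div_le_iff₀ (by positivity)]
    have e : (2 * c.A11 - 4 * (c.A11 / 6 + D ^ 2 / (3 * c.A11))) * (3 * c.A11)
        = 4 * (c.A11 ^ 2 - D ^ 2) := by
      field_simp
      ring
    rw [e]
    nlinarith

theorem abs_sign_mul_sign {p q : ℤ} (hp : p = -1 ∨ p = 1) (hq : q = -1 ∨ q = 1) :
    |(p : ℝ) * q| = 1 := by
  rcases hp with rfl | rfl <;> rcases hq with rfl | rfl <;> simp

theorem AlphaMoments.alpha_nonneg (hm : AlphaMoments c C h α) (hh : 0 < h) {η : ℝ}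
    (h1 : ∀ s : ℝ, |s| = 1 → η ≤ 2 * (s * c.A12) + 4 * (c.A11 / 6 + c.A12 ^ 2 / (3 * c.A11)))
    (h2 : η ≤ 2 * c.A11 - 4 * (c.A11 / 6 + c.A12 ^ 2 / (3 * c.A11))) (hη : 9 * C * h ≤ η)
    {p q : ℤ} (hp : p ∈ offsets) (hq : q ∈ offsets) (hpq : ¬ (p = 0 ∧ q = 0)) : 0 ≤ α p q := by
  have hh4 : 0 < h ^ 4 := by positivity
  have key : ∀ {t x y : ℝ}, |t * (h ^ 4 * y) - h ^ 2 * x| ≤ 9 * C * h ^ 3 → η ≤ x → 0 < t →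
      0 ≤ y := by
    intro t x y hy hx ht
    have a1 := (abs_le.1 hy).1
    have a2 : 9 * C * h * h ^ 2 ≤ x * h ^ 2 :=
      mul_le_mul_of_nonneg_right (hη.trans hx) (sq_nonneg h)
    have a3 : 0 ≤ t * (h ^ 4 * y) := by linarith
    exact nonneg_of_mul_nonneg_right (nonneg_of_mul_nonneg_right a3 ht) hh4
  rcases eq_or_ne p 0 with rfl | hp0
  · have hq' : q = -1 ∨ q = 1 := by have := mem_offsets_iff.1 hq; omega
    exact key (hm.vertical hh hq') h2 two_pos
  · have hp' : p = -1 ∨ p = 1 := by have := mem_offsets_iff.1 hp; omega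
    rcases eq_or_ne q 0 with rfl | hq0
    · exact key (hm.horizontal hh hp') h2 two_pos
    · have hq' : q = -1 ∨ q = 1 := by have := mem_offsets_iff.1 hq; omega
      exact key (hm.corner hh hp' hq') (h1 _ (abs_sign_mul_sign hp' hq')) four_pos

theorem AlphaMoments.abs_alpha_le (hm : AlphaMoments c C h α) (hh : 0 < h) (hh1 : h ≤ 1)
    {p q : ℤ} (hp : p ∈ offsets) (hq : q ∈ offsets) :
    |α p q| ≤ (9 * C + |c.K| + 2 * |c.A12| + 4 * |c.A11|
      + 4 * |c.A11 / 6 + c.A12 ^ 2 / (3 * c.A11)|) / h ^ 2 := by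
  have hC := hm.nonneg
  have hh2 : 0 < h ^ 2 := by positivity
  have key : ∀ {t x y B : ℝ}, |t * (h ^ 4 * y) - h ^ 2 * x| ≤ 9 * C * h ^ 3 → |x| ≤ B → 1 ≤ t →
      |y| ≤ (9 * C + B) / h ^ 2 := by
    intro t x y B hy hx ht
    have e : t * (h ^ 4 * y) - h ^ 2 * x = h ^ 2 * (t * (h ^ 2 * y) - x) := by ring
    rw [e, abs_mul, abs_of_pos hh2] at hy
    have a1 : |t * (h ^ 2 * y) - x| ≤ 9 * C * h :=
      le_of_mul_le_mul_left (hy.trans_eq (by ring)) hh2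
    have a2 : |t * (h ^ 2 * y)| ≤ 9 * C + B := by
      have := abs_sub_abs_le_abs_sub (t * (h ^ 2 * y)) x
      nlinarith
    rw [abs_mul, abs_mul, abs_of_pos hh2, abs_of_pos (by linarith : 0 < t)] at a2
    rw [le_div_iff₀ hh2]
    have : 0 ≤ h ^ 2 * |y| := by positivity
    nlinarith
  set m := c.A11 / 6 + c.A12 ^ 2 / (3 * c.A11) with hmdef
  have n1 := abs_nonneg c.K
  have n2 := abs_nonneg c.A12
  have n3 := abs_nonneg c.A11
  obtain ⟨l1, u1⟩ := abs_le.1 (le_refl |c.K|)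
  obtain ⟨l2, u2⟩ := abs_le.1 (le_refl |c.A12|)
  obtain ⟨l3, u3⟩ := abs_le.1 (le_refl |c.A11|)
  obtain ⟨l4, u4⟩ := abs_le.1 (le_refl |m|)
  have n4 := abs_nonneg m
  have hedge : |2 * c.A11 - 4 * m| ≤ |c.K| + 2 * |c.A12| + 4 * |c.A11| + 4 * |m| := by
    rw [abs_le]
    constructor <;> linarith
  have hcor : ∀ s : ℝ, |s| = 1 → |2 * (s * c.A12) + 4 * m|
      ≤ |c.K| + 2 * |c.A12| + 4 * |c.A11| + 4 * |m| := by
    intro s hs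
    have h1 : |s * c.A12| = |c.A12| := by rw [abs_mul, hs, one_mul]
    obtain ⟨l5, u5⟩ := abs_le.1 h1.le
    rw [abs_le]
    constructor <;> linarith
  have hcen : |h ^ 2 * c.K - 4 * c.A11 + 4 * m|
      ≤ |c.K| + 2 * |c.A12| + 4 * |c.A11| + 4 * |m| := by
    have h1 : |h ^ 2 * c.K| ≤ |c.K| := by
      rw [abs_mul, abs_of_pos hh2]
      exact mul_le_of_le_one_left n1 (pow_le_one₀ hh.le hh1)
    obtain ⟨l5, u5⟩ := abs_le.1 h1
    rw [abs_le]
    constructor <;> linarith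
  have fin : ∀ {y : ℝ}, |y| ≤ (9 * C + (|c.K| + 2 * |c.A12| + 4 * |c.A11| + 4 * |m|)) / h ^ 2 →
      |y| ≤ (9 * C + |c.K| + 2 * |c.A12| + 4 * |c.A11| + 4 * |m|) / h ^ 2 := by
    intro y hy
    simpa only [add_assoc] using hy
  apply fin
  rcases eq_or_ne p 0 with rfl | hp0
  · rcases eq_or_ne q 0 with rfl | hq0
    · exact key (t := 1) (by rw [one_mul]; exact hm.center hh hh1) hcen le_rfl
    · have hq' : q = -1 ∨ q = 1 := by have := mem_offsets_iff.1 hq; omega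
      exact key (hm.vertical hh hq') hedge (by norm_num)
  · have hp' : p = -1 ∨ p = 1 := by have := mem_offsets_iff.1 hp; omega
    rcases eq_or_ne q 0 with rfl | hq0
    · exact key (hm.horizontal hh hp') hedge (by norm_num)
    · have hq' : q = -1 ∨ q = 1 := by have := mem_offsets_iff.1 hq; omega
      exact key (hm.corner hh hp' hq') (hcor _ (abs_sign_mul_sign hp' hq')) (by norm_num)

/-- By `p ^ 3 = p` an order-five moment is `h⁴` times a bounded first moment or `h²` times a third
moment of size `O(h²)`. -/
theorem AlphaMoments.moment_five (hm : AlphaMoments c C h α) (hh : 0 < h) {k l : ℕ}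
    (hkl : k + l = 5) : |moment α h k l| ≤ C * h ^ 4 := by
  have hC := hm.nonneg
  have key : ∀ {t x y : ℝ} {n : ℕ}, x = t * h ^ n * y → 0 ≤ t → t ≤ 1 → ∀ m, n + m = 4 →
      |y| ≤ C * h ^ m → |x| ≤ C * h ^ 4 := by
    intro t x y n hx ht ht1 m hnm hy
    rw [hx, abs_mul, abs_of_nonneg (by positivity)]
    calc t * h ^ n * |y| ≤ 1 * h ^ n * (C * h ^ m) := by gcongr
      _ = C * h ^ 4 := by rw [← hnm, pow_add]; ring
  have hk : k ≤ 5 := by omega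
  obtain rfl : l = 5 - k := by omega
  interval_cases k
  · refine key (t := 1 / 120) (n := 4) (y := moment α h 0 1) ?_ (by norm_num) (by norm_num) 0 rfl
      (by simpa using hm.m01)
    simp [moment, stencilSum_eq, Nat.factorial]; ring
  · refine key (t := 1 / 12) (n := 2) (y := moment α h 1 2) ?_ (by norm_num) (by norm_num) 2 rfl
      hm.m12
    simp [moment, stencilSum_eq, Nat.factorial]; ring
  · refine key (t := 1 / 6) (n := 2) (y := moment α h 2 1) ?_ (by norm_num) (by norm_num) 2 rfl
      hm.m21
    simp [moment, stencilSum_eq, Nat.factorial]; ring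
  · refine key (t := 1 / 6) (n := 2) (y := moment α h 1 2) ?_ (by norm_num) (by norm_num) 2 rfl
      hm.m12
    simp [moment, stencilSum_eq, Nat.factorial]; ring
  · refine key (t := 1 / 12) (n := 2) (y := moment α h 2 1) ?_ (by norm_num) (by norm_num) 2 rfl
      hm.m21
    simp [moment, stencilSum_eq, Nat.factorial]; ring
  · refine key (t := 1 / 120) (n := 4) (y := moment α h 1 0) ?_ (by norm_num) (by norm_num) 0 rfl
      (by simpa using hm.m10)
    simp [moment, stencilSum_eq, Nat.factorial]; ring

end

/-- The factor `h³` is automatic; the fourth power of `h` is the near central symmetry of `β`. -/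
theorem abs_moment_three_le {β : Stencil} {M h : ℝ} (hM : 0 ≤ M) (hh : 0 < h)
    (hβ : ∀ p ∈ offsets, ∀ q ∈ offsets, |β p q - β (-p) (-q)| ≤ M * h) {k l : ℕ}
    (hkl : k + l = 3) : |moment β h k l| ≤ 5 * M * h ^ 4 := by
  have h2 := two_mul_moment_of_odd β h (k := k) (l := l) (by rw [hkl]; decide)
  have aux : ∀ p ∈ offsets, |(p : ℝ) * h| ≤ h := by
    intro p hp
    rw [abs_mul, abs_of_pos hh]
    rcases mem_offsets_iff.1 hp with rfl | rfl | rfl <;> simp [hh.le]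
  have h9 : |2 * moment β h k l| ≤ 9 * (M * h * h ^ 3) := by
    rw [h2]
    refine abs_stencilSum_le fun p hp q hq => ?_
    rw [abs_mul]
    refine mul_le_mul (hβ p hp q hq) ?_ (abs_nonneg _) (by positivity)
    rw [abs_div, abs_mul, abs_pow, abs_pow, ← hkl, pow_add]
    have f1 : (1 : ℝ) ≤ k ! := by exact_mod_cast Nat.factorial_pos k
    have f2 : (1 : ℝ) ≤ l ! := by exact_mod_cast Nat.factorial_pos l
    refine (div_le_self (by positivity) ?_).trans
      (mul_le_mul (pow_le_pow_left₀ (abs_nonneg _) (aux p hp) k)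
        (pow_le_pow_left₀ (abs_nonneg _) (aux q hq) l) (by positivity) (by positivity))
    rw [abs_of_pos (by positivity)]
    nlinarith
  rw [abs_mul, abs_two] at h9
  have : 0 ≤ M * h ^ 4 := by positivity
  linarith

theorem IsHOCFamily.asymptoticallyFourthOrder {c : Coeffs} (hA : c.A22 = c.A11)
    (hc : 2 * |c.A12| < c.A11) (hK : c.K ≤ 0) (xl yl : ℝ) {L : ℝ} (hL : 0 < L)
    {α β : ℝ → Stencil} (hαβ : IsHOCFamily c α β) :
    AsymptoticallyFourthOrder c xl yl L α β := by
  have hA0 : 0 < c.A11 := by linarith [abs_nonneg c.A12]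
  obtain ⟨h₁, hh₁, hnorm⟩ := hαβ.normalized
  obtain ⟨M, h₂, hh₂, hM⟩ := hαβ.bounds
  obtain ⟨C₀, h₃, hh₃, hh₃', hmom⟩ := exists_alphaMoments c hA hA0 M
  obtain ⟨η, hη, hη1, hη2⟩ := exists_coefficient_gap c hc
  set C := |C₀| with hC
  have hC0 : 0 ≤ C := abs_nonneg _
  -- With `moment (α h) h 2 0 ≥ A11 / 2`, `|moment (α h) h 1 0| ≤ C` and `γ h ≤ 1`, this makes the
  -- bracket in `StabilityBounds.second` at least `(3 C + 2) / 2 - 3 C / 2 = 1`.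
  set γ := (3 * C + 2) / c.A11 with hγ
  have hγ0 : 0 < γ := by positivity
  -- The row sum is only `K + O(h)` and may be slightly positive. This choice makes its cost `2 ε
  -- exp (γ L) = γ / 4`, leaving `δ = γ / 4` out of the available `γ / 2`.
  set ε := γ / (8 * Real.exp (γ * L)) with hε
  have hε0 : 0 < ε := by positivity
  obtain ⟨h₄, hh₄, hs⟩ : ∃ h₄ : ℝ, 0 < h₄ ∧ ∀ h, 0 < h → h ≤ h₄ →
      9 * C * h ≤ η ∧ C * h ≤ c.A11 / 2 ∧ C * h ≤ ε ∧ γ * h ≤ 1 := by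
    refine ⟨min (min (η / (9 * C + 1)) (c.A11 / 2 / (C + 1))) (min (ε / (C + 1)) (1 / γ)),
      by positivity, fun h hh hle => ?_⟩
    have a1 := (le_div_iff₀ (by positivity)).1 (hle.trans ((min_le_left _ _).trans (min_le_left _ _)))
    have a2 := (le_div_iff₀ (by positivity)).1 (hle.trans ((min_le_left _ _).trans (min_le_right _ _)))
    have a3 := (le_div_iff₀ (by positivity)).1 (hle.trans ((min_le_right _ _).trans (min_le_left _ _)))
    have a4 := (le_div_iff₀ (by positivity)).1 (hle.trans ((min_le_right _ _).trans (min_le_right _ _)))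
    refine ⟨?_, ?_, ?_, ?_⟩ <;> linarith
  set m := 9 * C + |c.K| + 2 * |c.A12| + 4 * |c.A11|
    + 4 * |c.A11 / 6 + c.A12 ^ 2 / (3 * c.A11)| with hm
  have hm0 : 0 ≤ m := by positivity
  refine ⟨min (min h₁ h₂) (min h₃ h₄), by positivity, fun f g u hu => ?_⟩
  obtain ⟨C', hC'⟩ := hu.exists_fourthOrderOnGrid hL (C + m + 5 * |M|) hγ0
    (δ := γ / 4) (by positivity) hε0.le
  refine ⟨C', fun N hN hle => hC' N hN _ _ ?_ ?_⟩
  all_goals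
    have hN' : (0 : ℝ) < N := by exact_mod_cast hN
    have hh : 0 < L / N := by positivity
    set h := L / N with hh_def
    have le1 : h ≤ h₁ := hle.trans ((min_le_left _ _).trans (min_le_left _ _))
    have le2 : h ≤ h₂ := hle.trans ((min_le_left _ _).trans (min_le_right _ _))
    have le3 : h ≤ h₃ := hle.trans ((min_le_right _ _).trans (min_le_left _ _))
    have le4 : h ≤ h₄ := hle.trans ((min_le_right _ _).trans (min_le_right _ _))
    have hh1 : h ≤ 1 := le3.trans hh₃'
    obtain ⟨hβ, hR⟩ := hM h hh le2
    have hmo := hmom h (α h) (β h) hh le3 ⟨hnorm h hh le1, hR⟩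
    have hCC : C₀ = C := (abs_of_nonneg (hmo.nonneg)).symm
    rw [hCC] at hmo
    obtain ⟨s1, s2, s3, s4⟩ := hs h hh le4
  · have hMM := le_abs_self M
    have hM0 := abs_nonneg M
    have hh4 : 0 ≤ h ^ 4 := by positivity
    refine ⟨fun p hp q hq => (hmo.abs_alpha_le hh hh1 hp hq).trans ?_,
      fun p hp q hq => (hβ p hp q hq).1.trans (by linarith),
      fun k l hkl => (hmo.moment_five hh hkl).trans ?_, fun k l hkl =>
        (abs_moment_three_le hM0 hh (fun p hp q hq => (hβ p hp q hq).2.trans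
          (mul_le_mul_of_nonneg_right hMM hh.le)) hkl).trans ?_, fun k l hkl => (hR k l hkl).trans ?_⟩
    · exact div_le_div_of_nonneg_right (by linarith) (sq_nonneg h)
    · exact mul_le_mul_of_nonneg_right (by linarith) hh4
    · exact mul_le_mul_of_nonneg_right (by linarith) hh4
    · exact mul_le_mul_of_nonneg_right (by linarith) hh4
  · refine ⟨fun p hp q hq hpq => hmo.alpha_nonneg hh hη1 hη2 s1 hp hq hpq, ?_, ?_⟩
    · have := (abs_le.1 hmo.m00).2
      linarith
    · have e1 : 2 * ε * Real.exp (γ * L) = γ / 4 := by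
        rw [hε]
        field_simp
        norm_num
      have b1 := (abs_le.1 hmo.m20).1
      have b2 := (abs_le.1 hmo.m10).1
      have hz : 1 ≤ 1 + γ * h := by nlinarith
      have b3 : 1 ≤ γ * moment (α h) h 2 0 + (1 + γ * h / 2) * moment (α h) h 1 0 := by
        have c1 : γ * (c.A11 / 2) ≤ γ * moment (α h) h 2 0 :=
          mul_le_mul_of_nonneg_left (by linarith) hγ0.le
        have c2 : γ * (c.A11 / 2) = (3 * C + 2) / 2 := by rw [hγ]; field_simp
        have c3 : (1 + γ * h / 2) * (-C) ≤ (1 + γ * h / 2) * moment (α h) h 1 0 :=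
          mul_le_mul_of_nonneg_left b2 (by linarith)
        nlinarith
      have b4 : γ / 2 ≤ γ / (1 + γ * h) :=
        div_le_div_of_nonneg_left hγ0.le (by linarith) (by linarith)
      rw [e1]
      calc γ / 4 + γ / 4 = γ / 2 * 1 := by ring
        _ ≤ _ := mul_le_mul b4 b3 zero_le_one (by positivity)

/-! ### Existence of least squares solutions of minimal norm -/

/-- The image of the affine hyperplane is a translate of a finite-dimensional subspace, hence
closed, so it has a point nearest to zero even if `A` has a kernel. The minimizers form a closed
set, which again has a point nearest to zero. -/
theorem exists_minNorm_leastSquares {V W : Type*} [NormedAddCommGroup V] [NormedSpace ℝ V]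
    [FiniteDimensional ℝ V] [NormedAddCommGroup W] [NormedSpace ℝ W] [FiniteDimensional ℝ W]
    (A : V →ₗ[ℝ] W) (ell : V →ₗ[ℝ] ℝ) (hell : ∃ x, ell x = 1) :
    ∃ x, ell x = 1 ∧ (∀ y, ell y = 1 → ‖A x‖ ≤ ‖A y‖) ∧
      ∀ y, ell y = 1 → ‖A y‖ ≤ ‖A x‖ → ‖x‖ ≤ ‖y‖ := by
  have := FiniteDimensional.proper ℝ V
  have := FiniteDimensional.proper ℝ W
  obtain ⟨x₀, hx₀⟩ := hell
  have himage : A '' {x | ell x = 1} = (fun w => A x₀ + w) '' ((LinearMap.ker ell).map A : Set W) := by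
    ext w
    constructor
    · rintro ⟨x, hx, rfl⟩
      refine ⟨A (x - x₀), ⟨x - x₀, ?_, rfl⟩, by simp⟩
      have hx' : ell x = 1 := hx
      simp [hx', hx₀]
    · rintro ⟨_, ⟨v, hv, rfl⟩, rfl⟩
      refine ⟨x₀ + v, ?_, map_add _ _ _⟩
      have hv' : ell v = 0 := hv
      simp [hv', hx₀]
  have hclosed : IsClosed (A '' {x | ell x = 1}) := by
    rw [himage]
    exact (Homeomorph.addLeft (A x₀)).isClosedMap _ (Submodule.closed_of_finiteDimensional _)
  obtain ⟨_, ⟨x₁, hx₁, rfl⟩, hmin⟩ := hclosed.exists_infDist_eq_dist ⟨A x₀, x₀, hx₀, rfl⟩ 0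
  have hmin' : ∀ y, ell y = 1 → ‖A x₁‖ ≤ ‖A y‖ := by
    intro y hy
    have := Metric.infDist_le_dist_of_mem (x := (0 : W)) (Set.mem_image_of_mem A (show y ∈ {x | ell x = 1} from hy))
    rwa [hmin, dist_zero_left, dist_zero_left] at this
  have hAc : Continuous A := A.continuous_of_finiteDimensional
  have hellc : Continuous ell := ell.continuous_of_finiteDimensional
  have hclosed' : IsClosed {x | ell x = 1 ∧ ‖A x‖ ≤ ‖A x₁‖} :=
    (isClosed_eq hellc continuous_const).inter (isClosed_le hAc.norm continuous_const)
  obtain ⟨x, ⟨hx, hAx⟩, hxmin⟩ := hclosed'.exists_infDist_eq_dist ⟨x₁, hx₁, le_rfl⟩ 0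
  refine ⟨x, hx, fun y hy => hAx.trans (hmin' y hy), fun y hy hAy => ?_⟩
  have hy' : y ∈ {x | ell x = 1 ∧ ‖A x‖ ≤ ‖A x₁‖} := ⟨hy, hAy.trans hAx⟩
  have := Metric.infDist_le_dist_of_mem (x := (0 : V)) hy'
  rwa [hxmin, dist_zero_left, dist_zero_left] at this

/-- The coordinate space of pairs of nine-point stencils. -/
abbrev StencilSpace : Type := EuclideanSpace ℝ (Bool × (offsets × offsets))

/-- The two stencils with given coordinates. -/
def StencilSpace.stencil (x : StencilSpace) (b : Bool) : Stencil := fun p q =>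
  if h : p ∈ offsets ∧ q ∈ offsets then x (b, ⟨p, h.1⟩, ⟨q, h.2⟩) else 0

/-- The coordinates of two stencils. -/
def stencilCoords (α β : Stencil) : StencilSpace :=
  WithLp.toLp 2 fun m => if m.1 then α m.2.1 m.2.2 else β m.2.1 m.2.2

theorem stencil_stencilCoords (α β : Stencil) {p q : ℤ} (hp : p ∈ offsets) (hq : q ∈ offsets) :
    (stencilCoords α β).stencil true p q = α p q ∧
      (stencilCoords α β).stencil false p q = β p q := by
  simp [StencilSpace.stencil, stencilCoords, hp, hq]

theorem stencil_add (x y : StencilSpace) (b : Bool) (p q : ℤ) :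
    (x + y).stencil b p q = x.stencil b p q + y.stencil b p q := by
  unfold StencilSpace.stencil
  split_ifs <;> simp

theorem stencil_smul (t : ℝ) (x : StencilSpace) (b : Bool) (p q : ℤ) :
    (t • x).stencil b p q = t * x.stencil b p q := by
  unfold StencilSpace.stencil
  split_ifs <;> simp

theorem norm_sq_eq_coeffNormSq (x : StencilSpace) :
    ‖x‖ ^ 2 = coeffNormSq (x.stencil true) (x.stencil false) := by
  have key : ∀ b, ∑ m : offsets × offsets, x (b, m) ^ 2
      = stencilSum (fun p q => x.stencil b p q ^ 2) := by
    intro b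
    rw [Fintype.sum_prod_type, stencilSum, ← Finset.sum_coe_sort offsets]
    refine Finset.sum_congr rfl fun p _ => ?_
    rw [← Finset.sum_coe_sort offsets]
    refine Finset.sum_congr rfl fun q _ => ?_
    simp [StencilSpace.stencil]
  rw [EuclideanSpace.real_norm_sq_eq, Fintype.sum_prod_type, Fintype.sum_bool, key, key,
    coeffNormSq]

/-! ### Linearity of moments and residuals in the stencils -/

theorem moment_add (γ δ : Stencil) (h : ℝ) (k l : ℕ) :
    moment (fun p q => γ p q + δ p q) h k l = moment γ h k l + moment δ h k l := by
  simp only [moment, add_mul, stencilSum_add]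

theorem moment_smul (t : ℝ) (γ : Stencil) (h : ℝ) (k l : ℕ) :
    moment (fun p q => t * γ p q) h k l = t * moment γ h k l := by
  simp only [moment, mul_assoc, stencilSum_mul_left]

theorem moment_congr {γ δ : Stencil} (h : ℝ) (hγ : ∀ p ∈ offsets, ∀ q ∈ offsets, γ p q = δ p q)
    (k l : ℕ) : moment γ h k l = moment δ h k l :=
  stencilSum_congr fun p hp q hq => by rw [hγ p hp q hq]

theorem matchingResidual_add (c : Coeffs) (h : ℝ) (α β α' β' : Stencil) (k l : ℕ) :
    matchingResidual c h (fun p q => α p q + α' p q) (fun p q => β p q + β' p q) k l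
      = matchingResidual c h α β k l + matchingResidual c h α' β' k l := by
  simp only [matchingResidual, moment_add, Finset.sum_range_succ, Finset.range_zero,
    Finset.sum_empty]
  norm_num
  ring

theorem matchingResidual_smul (c : Coeffs) (h t : ℝ) (α β : Stencil) (k l : ℕ) :
    matchingResidual c h (fun p q => t * α p q) (fun p q => t * β p q) k l
      = t * matchingResidual c h α β k l := by
  simp only [matchingResidual, moment_smul, Finset.sum_range_succ, Finset.range_zero,
    Finset.sum_empty]
  norm_num
  ring

theorem matchingResidual_congr (c : Coeffs) (h : ℝ) {α β α' β' : Stencil}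
    (hα : ∀ k l, moment α h k l = moment α' h k l)
    (hβ : ∀ k l, k + l ≤ 2 → moment β h k l = moment β' h k l) (k l : ℕ) :
    matchingResidual c h α β k l = matchingResidual c h α' β' k l := by
  unfold matchingResidual
  rw [hα]
  congr 1
  refine Finset.sum_congr rfl fun r _ => Finset.sum_congr rfl fun s _ => ?_
  split_ifs with hrs
  · rw [hβ r s hrs]
  · rfl

theorem residualSq_congr (c : Coeffs) (h : ℝ) {α β α' β' : Stencil}
    (hα : ∀ k l, moment α h k l = moment α' h k l)
    (hβ : ∀ k l, k + l ≤ 2 → moment β h k l = moment β' h k l) :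
    residualSq c h α β = residualSq c h α' β' := by
  simp only [residualSq, matchingResidual_congr c h hα hβ]

/-- The residuals as a linear map. -/
def residualMap (c : Coeffs) (h : ℝ) :
    StencilSpace →ₗ[ℝ] EuclideanSpace ℝ (Fin 5 × Fin 5) where
  toFun x := WithLp.toLp 2 fun m => if (m.1 : ℕ) + m.2 ≤ 4 then
    matchingResidual c h (x.stencil true) (x.stencil false) m.1 m.2 else 0
  map_add' x y := by
    ext m
    have e : ∀ b, (x + y).stencil b = fun p q => x.stencil b p q + y.stencil b p q :=
      fun b => funext fun p => funext fun q => stencil_add x y b p q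
    simp only [e, matchingResidual_add, PiLp.add_apply]
    split_ifs <;> simp
  map_smul' t x := by
    ext m
    have e : ∀ b, (t • x).stencil b = fun p q => t * x.stencil b p q :=
      fun b => funext fun p => funext fun q => stencil_smul t x b p q
    simp only [e, matchingResidual_smul, PiLp.smul_apply]
    split_ifs <;> simp

theorem norm_sq_residualMap (c : Coeffs) (h : ℝ) (x : StencilSpace) :
    ‖residualMap c h x‖ ^ 2 = residualSq c h (x.stencil true) (x.stencil false) := by
  rw [EuclideanSpace.real_norm_sq_eq, Fintype.sum_prod_type, residualSq, Finset.sum_range]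
  refine Finset.sum_congr rfl fun k _ => ?_
  rw [Finset.sum_range]
  refine Finset.sum_congr rfl fun l _ => ?_
  simp only [residualMap, LinearMap.coe_mk, AddHom.coe_mk]
  split_ifs <;> simp

/-- The sum of the second stencil as a linear map. -/
def betaSum : StencilSpace →ₗ[ℝ] ℝ where
  toFun x := stencilSum (x.stencil false)
  map_add' x y := by 
    rw [← stencilSum_add]
    exact stencilSum_congr fun p _ q _ => stencil_add x y false p q
  map_smul' t x := by
    rw [RingHom.id_apply, smul_eq_mul, ← stencilSum_mul_left]
    exact stencilSum_congr fun p _ q _ => stencil_smul t x false p q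

theorem exists_isSVDSolution (c : Coeffs) (h : ℝ) : ∃ α β : Stencil, IsSVDSolution c h α β := by
  have hsum : ∀ α β : Stencil, betaSum (stencilCoords α β) = stencilSum β := fun α β =>
    stencilSum_congr fun p hp q hq => (stencil_stencilCoords α β hp hq).2
  have hres : ∀ α β : Stencil, ‖residualMap c h (stencilCoords α β)‖ ^ 2 = residualSq c h α β := by
    intro α β
    rw [norm_sq_residualMap]
    exact residualSq_congr c h
      (moment_congr h fun p hp q hq => (stencil_stencilCoords α β hp hq).1)
      (fun k l _ => moment_congr h (fun p hp q hq => (stencil_stencilCoords α β hp hq).2) k l)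
  have hnorm : ∀ α β : Stencil, ‖stencilCoords α β‖ ^ 2 = coeffNormSq α β := by
    intro α β
    rw [norm_sq_eq_coeffNormSq]
    exact congrArg₂ (· + ·)
      (stencilSum_congr fun p hp q hq => by rw [(stencil_stencilCoords α β hp hq).1])
      (stencilSum_congr fun p hp q hq => by rw [(stencil_stencilCoords α β hp hq).2])
  obtain ⟨x, hx, hls, hmin⟩ := exists_minNorm_leastSquares (residualMap c h) betaSum
    ⟨stencilCoords 0 (fun _ _ => 1 / 9), by rw [hsum, stencilSum_eq]; norm_num⟩
  refine ⟨x.stencil true, x.stencil false, hx, fun α' β' hβ' => ?_, fun α' β' hβ' hle => ?_⟩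
  · rw [← norm_sq_residualMap, ← hres]
    exact pow_le_pow_left₀ (norm_nonneg _) (hls _ ((hsum α' β').trans hβ')) 2
  · rw [← norm_sq_residualMap, ← hres] at hle
    rw [← norm_sq_eq_coeffNormSq, ← hnorm]
    exact pow_le_pow_left₀ (norm_nonneg _) (hmin _ ((hsum α' β').trans hβ')
      (le_of_sq_le_sq hle (norm_nonneg _))) 2

/-! ### Nearly consistent coefficients exist -/

/-- The stencil with prescribed moments of orders at most two in each variable. -/
def interpolant (μ : ℕ → ℕ → ℝ) (h : ℝ) : Stencil := fun p q =>
  μ 0 0 * ((1 - p ^ 2) * (1 - q ^ 2)) + μ 1 0 / h * (p / 2 * (1 - q ^ 2))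
    + μ 0 1 / h * ((1 - p ^ 2) * (q / 2)) + μ 2 0 / h ^ 2 * ((3 * p ^ 2 - 2) * (1 - q ^ 2))
    + μ 0 2 / h ^ 2 * ((1 - p ^ 2) * (3 * q ^ 2 - 2)) + μ 1 1 / h ^ 2 * (p * q / 4)
    + μ 2 1 / h ^ 3 * ((3 * p ^ 2 - 2) * q / 2) + μ 1 2 / h ^ 3 * (p * (3 * q ^ 2 - 2) / 2)
    + μ 2 2 / h ^ 4 * ((3 * p ^ 2 - 2) * (3 * q ^ 2 - 2))

theorem moment_interpolant (μ : ℕ → ℕ → ℝ) {h : ℝ} (hh : h ≠ 0) {k l : ℕ} (hk : k ≤ 2)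
    (hl : l ≤ 2) : moment (interpolant μ h) h k l = μ k l := by
  interval_cases k <;> interval_cases l <;>
    simp [moment, stencilSum_eq, interpolant] <;> field_simp <;> ring

/-- Prescribing the nine moments of `α` makes all residuals with `k, l ≤ 2` vanish. The six others
are then conditions on `β` alone, and the leading-order moments of `β` satisfy them up to `h⁴`. -/
theorem exists_nearlyConsistent (c : Coeffs) (hA : c.A22 = c.A11) (hA0 : 0 < c.A11) :
    ∃ M : ℝ, ∀ h : ℝ, 0 < h → ∃ α β : Stencil, NearlyConsistent c M h α β := by
  -- These values cancel the `h²` terms of the eliminated equations. The default `h² / 12` matters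
  -- only at `(2,0)` and `(0,2)`: moments of `β` of order above two do not enter the system.
  let μ : ℝ → ℕ → ℕ → ℝ := fun h r s =>
    if r = 0 ∧ s = 0 then 1
    else if r = 1 ∧ s = 0 then h ^ 2 * (c.a / (12 * c.A11))
    else if r = 0 ∧ s = 1 then h ^ 2 * (c.b / (12 * c.A11))
    else if r = 1 ∧ s = 1 then h ^ 2 * (c.A12 / (6 * c.A11))
    else h ^ 2 / 12
  let ρ : ℕ → ℕ → ℝ := fun k l =>
    if k = 3 ∧ l = 0 then c.K * c.a / (72 * c.A11)
    else if k = 0 ∧ l = 3 then c.K * c.b / (72 * c.A11)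
    else if k = 4 ∧ l = 0 then (c.a ^ 2 / c.A11 + c.K) / 144
    else if k = 0 ∧ l = 4 then (c.b ^ 2 / c.A11 + c.K) / 144
    else if (k = 3 ∧ l = 1) ∨ (k = 1 ∧ l = 3) then
      (c.a * c.b + c.K * c.A12) / (36 * c.A11)
    else 0
  have hρ : ∀ k l, k + l ≤ 4 → |ρ k l| ≤ ∑ m ∈ Finset.range 5 ×ˢ Finset.range 5, |ρ m.1 m.2| :=
    fun k l hkl => Finset.single_le_sum (f := fun m : ℕ × ℕ => |ρ m.1 m.2|) (a := (k, l))
      (fun _ _ => abs_nonneg _) (by simp; omega)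
  refine ⟨∑ m ∈ Finset.range 5 ×ˢ Finset.range 5, |ρ m.1 m.2|, fun h hh => ?_⟩
  set β := interpolant (μ h) h with hβ
  have hm : ∀ {r s}, r ≤ 2 → s ≤ 2 → moment β h r s = μ h r s :=
    fun hr hs => moment_interpolant (μ h) hh.ne' hr hs
  set ν : ℕ → ℕ → ℝ := fun k l => ∑ r ∈ Finset.range 3, ∑ s ∈ Finset.range 3,
    if r + s ≤ 2 then moment β h r s * pdeCoeff c r s k l else 0 with hν
  have hα : ∀ {k l}, k ≤ 2 → l ≤ 2 → moment (interpolant ν h) h k l = ν k l :=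
    fun hk hl => moment_interpolant ν hh.ne' hk hl
  have m00 : moment β h 0 0 = 1 := hm (by omega) (by omega)
  have m10 : moment β h 1 0 = h ^ 2 * (c.a / (12 * c.A11)) := hm (by omega) (by omega)
  have m01 : moment β h 0 1 = h ^ 2 * (c.b / (12 * c.A11)) := hm (by omega) (by omega)
  have m11 : moment β h 1 1 = h ^ 2 * (c.A12 / (6 * c.A11)) := hm (by omega) (by omega)
  have m20 : moment β h 2 0 = h ^ 2 / 12 := hm (by omega) (by omega)
  have m02 : moment β h 0 2 = h ^ 2 / 12 := hm (by omega) (by omega)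
  have m13 : ∀ γ : Stencil, moment γ h 1 3 = h ^ 2 / 6 * moment γ h 1 1 := by
    intro γ
    simp [moment, stencilSum_eq, Nat.factorial]; ring
  refine ⟨interpolant ν h, β, by rw [← moment_zero_zero β h, m00], fun k l hkl => ?_⟩
  have hR : matchingResidual c h (interpolant ν h) β k l = ρ k l * h ^ 4 := by
    by_cases hkl2 : k ≤ 2 ∧ l ≤ 2
    · have : ρ k l = 0 := by
        simp only [ρ]
        split_ifs <;> first | omega | rfl
      rw [matchingResidual, hα hkl2.1 hkl2.2, sub_self, this, zero_mul]
    · have hk : k ≤ 4 := by omega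
      have hl : l ≤ 4 := by omega
      interval_cases k <;> interval_cases l <;> first
        | omega
        | (rw [matchingResidual]
           simp only [moment_three_zero, moment_zero_three, moment_three_one, moment_four_zero,
             moment_zero_four, m13]
           rw [hα (by omega) (by omega), hν]
           simp [pdeCoeff, Finset.sum_range_succ, m00, m10, m01, m11, m20, m02, ρ, hA]
           field_simp
           ring)
  rw [hR, abs_mul, abs_of_pos (pow_pos hh 4)]
  exact mul_le_mul_of_nonneg_right (hρ k l hkl) (pow_pos hh 4).le

/-! ### The SVD solutions -/

section

variable {c : Coeffs} {h : ℝ} {α β : Stencil}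

theorem IsSVDSolution.nearlyConsistent (hs : IsSVDSolution c h α β) (hh : 0 < h) {M : ℝ}
    {α' β' : Stencil} (hc : NearlyConsistent c M h α' β') :
    NearlyConsistent c (5 * M) h α β := by
  have hM := hc.zero_le hh
  refine ⟨hs.normalized, fun k l hkl => ?_⟩
  -- All 25 terms of the double sum are counted, whence the factor `5` in the conclusion.
  have h1 : residualSq c h α' β' ≤ 25 * (M * h ^ 4) ^ 2 := by
    have : ∀ k l, (if k + l ≤ 4 then matchingResidual c h α' β' k l ^ 2 else 0)
        ≤ (M * h ^ 4) ^ 2 := by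
      intro k l
      split_ifs with hkl
      · exact sq_le_sq' (abs_le.1 (hc.residual k l hkl)).1 (abs_le.1 (hc.residual k l hkl)).2
      · positivity
    refine (Finset.sum_le_sum fun k _ => Finset.sum_le_sum fun l _ => this k l).trans_eq ?_
    simp
    ring
  have h2 : matchingResidual c h α β k l ^ 2 ≤ residualSq c h α β := by
    have e := Finset.single_le_sum (f := fun m : ℕ × ℕ =>
      if m.1 + m.2 ≤ 4 then matchingResidual c h α β m.1 m.2 ^ 2 else 0)
      (s := Finset.range 5 ×ˢ Finset.range 5) (a := (k, l))
      (fun m _ => by split_ifs <;> positivity) (by simp; omega)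
    rw [Finset.sum_product] at e
    simpa [hkl, residualSq] using e
  have h3 := h2.trans ((hs.leastSquares α' β' hc.normalized).trans h1)
  refine abs_le_of_sq_le_sq (h3.trans_eq (by ring)) (by positivity)

/-- Adding `t ν` to `β` changes neither the residuals nor the normalization, so least norm makes `t
= 0` minimize a quadratic polynomial in `t`. -/
theorem IsSVDSolution.orthogonal (hs : IsSVDSolution c h α β) {ν : Stencil}
    (hν : ∀ r s, r + s ≤ 2 → moment ν h r s = 0) (hν0 : 0 < stencilSum (fun p q => ν p q ^ 2)) :
    stencilSum (fun p q => β p q * ν p q) = 0 := by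
  set x := stencilSum (fun p q => β p q * ν p q) with hx
  set y := stencilSum (fun p q => ν p q ^ 2) with hy
  have key : ∀ t : ℝ, 0 ≤ 2 * t * x + t ^ 2 * y := by
    intro t
    have hmom : ∀ k l, k + l ≤ 2 →
        moment (fun p q => β p q + t * ν p q) h k l = moment β h k l := by
      intro k l hkl
      rw [moment_add β (fun p q => t * ν p q), moment_smul, hν k l hkl, mul_zero, add_zero]
    have hnorm : stencilSum (fun p q => β p q + t * ν p q) = 1 := by
      rw [← moment_zero_zero _ h, hmom 0 0 (by omega), moment_zero_zero, hs.normalized]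
    have := hs.minNorm α (fun p q => β p q + t * ν p q) hnorm
      (residualSq_congr c h (fun _ _ => rfl) hmom).le
    have e : stencilSum (fun p q => (β p q + t * ν p q) ^ 2)
        = stencilSum (fun p q => β p q ^ 2) + (2 * t * x + t ^ 2 * y) := by
      rw [hx, hy]
      simp only [stencilSum_eq]
      ring
    unfold coeffNormSq at this
    linarith
  have h1 := key (-x / y)
  have h2 : 2 * (-x / y) * x + (-x / y) ^ 2 * y = -(x ^ 2 / y) := by field_simp; ring
  rw [h2] at h1
  have h3 : x ^ 2 / y ≤ 0 := by linarith
  have h4 : x ^ 2 ≤ 0 := by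
    rw [div_le_iff₀ hν0, zero_mul] at h3
    exact h3
  exact pow_eq_zero_iff two_ne_zero |>.1 (le_antisymm h4 (sq_nonneg x))

/-- The functions `1, p, q, p q, 3 p² - 2, 3 q² - 2` and the three products in the proof are an
orthogonal basis of the nine-point stencils. The three products have no moments of order at most
two, so `β` is orthogonal to them. The denominators 9, 6, 4, 18 are squared norms. -/
theorem IsSVDSolution.beta_eq (hs : IsSVDSolution c h α β) (hh : h ≠ 0) {p q : ℤ}
    (hp : p ∈ offsets) (hq : q ∈ offsets) :
    β p q = 1 / 9 + moment β h 1 0 / h * p / 6 + moment β h 0 1 / h * q / 6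
      + moment β h 1 1 / h ^ 2 * (p * q) / 4
      + (6 * (moment β h 2 0 / h ^ 2) - 2) * (3 * p ^ 2 - 2) / 18
      + (6 * (moment β h 0 2 / h ^ 2) - 2) * (3 * q ^ 2 - 2) / 18 := by
  have small : ∀ {ν : Stencil}, stencilSum ν = 0 → moment ν h 1 0 = 0 → moment ν h 0 1 = 0 →
      moment ν h 1 1 = 0 → moment ν h 2 0 = 0 → moment ν h 0 2 = 0 →
      ∀ r s, r + s ≤ 2 → moment ν h r s = 0 := by
    intro ν h1 h2 h3 h4 h5 h6 r s hrs
    have hr : r ≤ 2 := by omega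
    have hs : s ≤ 2 := by omega
    rw [← moment_zero_zero ν h] at h1
    interval_cases r <;> interval_cases s <;> omega
  have o12 := hs.orthogonal (ν := fun p q => (p : ℝ) * (3 * q ^ 2 - 2))
    (by apply small <;> simp [moment, stencilSum_eq] <;> ring)
    (by simp [stencilSum_eq]; norm_num)
  have o21 := hs.orthogonal (ν := fun p q => (q : ℝ) * (3 * p ^ 2 - 2))
    (by apply small <;> simp [moment, stencilSum_eq] <;> ring)
    (by simp [stencilSum_eq]; norm_num)
  have o22 := hs.orthogonal (ν := fun p q => (3 * (p : ℝ) ^ 2 - 2) * (3 * q ^ 2 - 2))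
    (by apply small <;> simp [moment, stencilSum_eq] <;> ring)
    (by simp [stencilSum_eq]; norm_num)
  have o00 := hs.normalized
  have n10 : moment β h 1 0 / h = stencilSum fun p q => β p q * p := by
    simp [moment, stencilSum_eq]; field_simp
  have n01 : moment β h 0 1 / h = stencilSum fun p q => β p q * q := by
    simp [moment, stencilSum_eq]; field_simp
  have n11 : moment β h 1 1 / h ^ 2 = stencilSum fun p q => β p q * (p * q) := by
    simp [moment, stencilSum_eq]; field_simp
  have n20 : moment β h 2 0 / h ^ 2 = stencilSum fun p q => β p q * (p ^ 2 / 2) := by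
    simp [moment, stencilSum_eq]; field_simp
  have n02 : moment β h 0 2 / h ^ 2 = stencilSum fun p q => β p q * (q ^ 2 / 2) := by
    simp [moment, stencilSum_eq]; field_simp
  rw [n10, n01, n11, n20, n02]
  rcases mem_offsets_iff.1 hp with rfl | rfl | rfl <;>
    rcases mem_offsets_iff.1 hq with rfl | rfl | rfl <;>
    simp [stencilSum_eq] at o12 o21 o22 o00 ⊢ <;> linarith only [o12, o21, o22, o00]

end

/-- In the six-term form of `β` only the terms in `p` and `q` are odd. Their coefficients are first
moments, of size `O(h²)`, divided by `h`. -/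
theorem isHOCFamily_of_isSVDSolution {c : Coeffs} (hA : c.A22 = c.A11) (hA0 : 0 < c.A11)
    {α β : ℝ → Stencil} (hs : ∀ h : ℝ, 0 < h → IsSVDSolution c h (α h) (β h)) :
    IsHOCFamily c α β := by
  obtain ⟨M, hM⟩ := exists_nearlyConsistent c hA hA0
  have hnc : ∀ h, 0 < h → NearlyConsistent c (5 * M) h (α h) (β h) := by
    intro h hh
    obtain ⟨α', β', hc⟩ := hM h hh
    exact (hs h hh).nearlyConsistent hh hc
  obtain ⟨C, h₁, hC0, hh₁, hh₁', hC⟩ := exists_betaMoments c hA hA0 (5 * M)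
  refine ⟨⟨1, one_pos, fun h hh _ => (hs h hh).normalized⟩, 1 + 5 * C + 5 * M, h₁, hh₁,
    fun h hh hle => ?_⟩
  have hn := hnc h hh
  have hM0 := hn.zero_le hh
  have hle1 := hle.trans hh₁'
  have hS := (hC h _ _ hh hle hn).size
  obtain ⟨s10, s01, s20, s02, s11⟩ := moment_le_momentSize (β h) h
  refine ⟨fun p hp q hq => ?_, fun k l hkl => (hn.residual k l hkl).trans
    (mul_le_mul_of_nonneg_right (by linarith) (pow_pos hh 4).le)⟩
  have first : ∀ {x : ℝ}, |x| ≤ momentSize (β h) h → |x / h| ≤ C * h := by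
    intro x hx
    rw [abs_div, abs_of_pos hh, div_le_iff₀ hh]
    exact (hx.trans hS).trans_eq (by ring)
  have second : ∀ {x : ℝ}, |x| ≤ momentSize (β h) h → |x / h ^ 2| ≤ C := by
    intro x hx
    rw [abs_div, abs_of_pos (pow_pos hh 2), div_le_iff₀ (pow_pos hh 2)]
    exact hx.trans hS
  have t10 := abs_le.1 (first s10)
  have t01 := abs_le.1 (first s01)
  have t20 := abs_le.1 (second s20)
  have t02 := abs_le.1 (second s02)
  have t11 := abs_le.1 (second s11)
  have hCh : C * h ≤ C := mul_le_of_le_one_right hC0 hle1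
  have hCh0 : 0 ≤ C * h := by positivity
  have hMh : 0 ≤ 5 * M * h := by positivity
  have neg : ∀ {p : ℤ}, p ∈ offsets → -p ∈ offsets := fun hp => by
    have := mem_offsets_iff.1 hp
    exact mem_offsets_iff.2 (by omega)
  rw [(hs h hh).beta_eq hh.ne' (neg hp) (neg hq), (hs h hh).beta_eq hh.ne' hp hq, abs_le, abs_le]
  rcases mem_offsets_iff.1 hp with rfl | rfl | rfl <;>
    rcases mem_offsets_iff.1 hq with rfl | rfl | rfl <;>
    norm_num <;> repeat' apply And.intro
  all_goals
    linarith only [t10.1, t10.2, t01.1, t01.2, t20.1, t20.2, t02.1, t02.2, t11.1, t11.2, hCh,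
      hCh0, hMh, hM0, hh, hC0]

end HOC

end

/-! ### The main theorem -/

theorem mainTheorem4 (A11 A12 A22 K xl yl L : ℝ) (hA : A22 = A11) (hA12 : 2 * |A12| < A11)
    (hK : K ≤ 0) (hL : 0 < L) :
    -- 1) no advection, explicit coefficients: fourth-order accuracy
    HOC.FourthOrderAccurate ⟨A11, A12, A22, 0, 0, K⟩ xl yl L
      (HOC.anisAlpha A11 A12 K) (HOC.anisBeta A11 A12 K) ∧
    -- the explicit coefficients solve the linear system exactly, and are a HOC family
    (∀ h : ℝ, 0 < h → HOC.stencilSum (HOC.anisBeta A11 A12 K h) = 1 ∧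
      ∀ k l : ℕ, k + l ≤ 4 → HOC.matchingResidual ⟨A11, A12, A22, 0, 0, K⟩ h
        (HOC.anisAlpha A11 A12 K h) (HOC.anisBeta A11 A12 K h) k l = 0) ∧
    HOC.IsHOCFamily ⟨A11, A12, A22, 0, 0, K⟩
      (HOC.anisAlpha A11 A12 K) (HOC.anisBeta A11 A12 K) ∧
    -- 2) general constant advection: the HOC scheme with coefficients from the linear system
    -- exists and is asymptotically fourth-order convergent
    ∀ a b : ℝ,
      (∀ h : ℝ, 0 < h → ∃ α β : HOC.Stencil,
        HOC.IsSVDSolution ⟨A11, A12, A22, a, b, K⟩ h α β) ∧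
      (∀ α β : ℝ → HOC.Stencil,
        (∀ h : ℝ, 0 < h → HOC.IsSVDSolution ⟨A11, A12, A22, a, b, K⟩ h (α h) (β h)) →
        HOC.IsHOCFamily ⟨A11, A12, A22, a, b, K⟩ α β ∧
        HOC.AsymptoticallyFourthOrder ⟨A11, A12, A22, a, b, K⟩ xl yl L α β) ∧
      (∀ α β : ℝ → HOC.Stencil, HOC.IsHOCFamily ⟨A11, A12, A22, a, b, K⟩ α β →
        HOC.AsymptoticallyFourthOrder ⟨A11, A12, A22, a, b, K⟩ xl yl L α β) := by
  subst hA
  have hA0 : 0 < A22 := by linarith [abs_nonneg A12]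
  refine ⟨HOC.fourthOrderAccurate_anis hA0 hA12 hK xl yl hL,
    fun h hh => ⟨HOC.stencilSum_anisBeta hA0 hK,
      fun k l hkl => HOC.matchingResidual_anis hA0 hK hh hkl⟩,
    HOC.isHOCFamily_anis hA0 hA12 hK, fun a b => ?_⟩
  have hconv : ∀ α β : ℝ → HOC.Stencil, HOC.IsHOCFamily ⟨A22, A12, A22, a, b, K⟩ α β →
      HOC.AsymptoticallyFourthOrder ⟨A22, A12, A22, a, b, K⟩ xl yl L α β :=
    fun α β hαβ => hαβ.asymptoticallyFourthOrder rfl hA12 hK xl yl hL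
  refine ⟨fun h _ => HOC.exists_isSVDSolution _ h, fun α β hs => ?_, hconv⟩
  have hfam := HOC.isHOCFamily_of_isSVDSolution (c := ⟨A22, A12, A22, a, b, K⟩) rfl hA0 hs
  exact ⟨hfam, hconv α β hfam⟩
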